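/- Let $H$ be a complex Hilbert space, and let $\mathcal{CF}^{\mathrm{sa}}$ be the set of all (generally unbounded, densely defined) self-adjoint Fredholm operators in $H$, with the gap metric $\delta(S,T)=\|P_S-P_T\|$, where $P_T$ is the orthogonal projection of $H\times H$ onto the graph of $T$. Let $f:[0,1]\to\mathcal{CF}^{\mathrm{sa}}$ be continuous. *First definition (Cayley transform and winding number).* Let $u(t)=(f(t)-i)(f(t)+i)^{-1}$ be the Cayley transform of $f(t)$, a unitary operator for which $u(t)+I$ is Fredholm. Choose a partition $0=t_0<t_1<\dots<t_n=1$ and numbers $0<\varepsilon_j<\pi$ such that, for all $t\in[t_{j-1},t_j]$, $u(t)-e^{i(\pi+\theta)}$ is Fredholm whenever $|\theta|\le\varepsilon_j$, and $\ker(u(t)-e^{i(\pi\pm\varepsilon_j)})=\{0\}$. Put $k(t,\varepsilon)=\sum_{0\le\theta<\varepsilon}\dim\ker(u(t)-e^{i(\pi+\theta)})$. The spectral flow of $f$ is the winding number of $u$ (the net number of eigenvalues crossing $-1$ from the upper into the lower half-plane), defined as $$\operatorname{SF}(f)=\operatorname{wind}(u)=\sum_{j=1}^n\bigl(k(t_j,\varepsilon_j)-k(t_{j-1},\varepsilon_j)\bigr).$$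 *Second definition (Phillips).* Choose a partition $0=t_0<t_1<\dots<t_n=1$ and numbers $\varepsilon_j>0$ such that for each $j$ the spectral projections $E_j(t)=1_{[-\varepsilon_j,\varepsilon_j]}(f(t))$ are of finite rank and depend continuously (in the operator norm) on $t\in[t_{j-1},t_j]$. Let $E_j^{\ge}(t)$ be the projection onto the span of the eigenvectors of $f(t)$ in the range of $E_j(t)$ with non-negative eigenvalues. The spectral flow of $f$ is $$\operatorname{SF}(f)=\sum_{j=1}^n\bigl(\dim E_j^{\ge}(t_j)-\dim E_j^{\ge}(t_{j-1})\bigr).$$ Then in both definitions such choices exist, the resulting integer does not depend on them, and the two definitions give the same integer. -/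

import Mathlib

open scoped InnerProductSpace

noncomputable section

namespace SpectralFlow

variable {H : Type*} [NormedAddCommGroup H] [InnerProductSpace ℂ H] [CompleteSpace H]

/-! ### Self-adjoint operators, the gap metric, and Fredholm operators -/

/-- The set of (generally unbounded, densely defined) self-adjoint operators in `H`. -/
def SelfAdjointOp (H : Type*) [NormedAddCommGroup H] [InnerProductSpace ℂ H]
    [CompleteSpace H] : Type _ :=
  {T : H →ₗ.[ℂ] H // IsSelfAdjoint T}

/-- The graph of `T`, as a subspace of the Hilbert space `H × H`. -/
def graphSubspace (T : SelfAdjointOp H) : Submodule ℂ (WithLp 2 (H × H)) :=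
  T.1.graph.map ((WithLp.linearEquiv 2 ℂ (H × H)).symm : H × H →ₗ[ℂ] WithLp 2 (H × H))

theorem mem_graphSubspace {T : SelfAdjointOp H} {z : WithLp 2 (H × H)} :
    z ∈ graphSubspace T ↔ (z.fst, z.snd) ∈ T.1.graph := by
  constructor
  · rintro ⟨w, hw, rfl⟩
    exact hw
  · intro h
    exact ⟨_, h, rfl⟩

theorem isClosed_graphSubspace (T : SelfAdjointOp H) :
    IsClosed (graphSubspace T : Set (WithLp 2 (H × H))) := by
  have h : IsClosed (T.1.graph : Set (H × H)) := T.2.isClosed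
  have h2 := h.preimage (WithLp.prod_continuous_ofLp 2 H H)
  convert h2 using 1
  ext z
  exact mem_graphSubspace

instance (T : SelfAdjointOp H) : CompleteSpace (graphSubspace T) :=
  (isClosed_graphSubspace T).completeSpace_coe

/-- The orthogonal projection of `H × H` onto the graph of `T`. -/
def graphProjection (T : SelfAdjointOp H) : WithLp 2 (H × H) →L[ℂ] WithLp 2 (H × H) :=
  (graphSubspace T).starProjection

theorem graphProjection_injective :
    Function.Injective (graphProjection : SelfAdjointOp H → _) := by
  intro S T h
  have h1 : graphSubspace S = graphSubspace T := by
    have h2 : (graphSubspace S).starProjection = (graphSubspace T).starProjection := h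
    rw [← Submodule.range_starProjection (graphSubspace S), h2, Submodule.range_starProjection]
  apply Subtype.ext
  apply LinearPMap.eq_of_eq_graph
  ext ⟨x, y⟩
  have h2 := SetLike.ext_iff.1 h1 (WithLp.toLp 2 (x, y))
  rwa [mem_graphSubspace, mem_graphSubspace] at h2

/-- The gap metric `δ(S, T) = ‖P_S - P_T‖`, where `P_S`, `P_T` are the orthogonal projections onto
the graphs. -/
instance : MetricSpace (SelfAdjointOp H) :=
  MetricSpace.induced graphProjection graphProjection_injective inferInstance

/-- A (closed) operator is Fredholm if its kernel is finite-dimensional and its range is closed and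
of finite codimension. -/
structure IsFredholmOp (T : H →ₗ.[ℂ] H) : Prop where
  finiteDimensional_ker : FiniteDimensional ℂ (LinearMap.ker T.toFun)
  isClosed_range : IsClosed (LinearMap.range T.toFun : Set H)
  finiteDimensional_coker : FiniteDimensional ℂ (H ⧸ LinearMap.range T.toFun)

/-- The space of self-adjoint Fredholm operators in `H`, with the gap metric. -/
abbrev FredholmSA (H : Type*) [NormedAddCommGroup H] [InnerProductSpace ℂ H]
    [CompleteSpace H] : Type _ :=
  {T : SelfAdjointOp H // IsFredholmOp T.1}

/-! ### The resolvent at `-i` and the Cayley transform -/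

/-- `T + i`, as a linear map on the domain of `T`. -/
def addI (T : SelfAdjointOp H) : T.1.domain →ₗ[ℂ] H :=
  T.1.toFun + Complex.I • T.1.domain.subtype

/-- `T - i`, as a linear map on the domain of `T`. -/
def subI (T : SelfAdjointOp H) : T.1.domain →ₗ[ℂ] H :=
  T.1.toFun - Complex.I • T.1.domain.subtype

theorem inner_symm (T : SelfAdjointOp H) (x y : T.1.domain) :
    ⟪T.1 x, (y : H)⟫_ℂ = ⟪(x : H), T.1 y⟫_ℂ := by
  have h := LinearPMap.adjoint_isFormalAdjoint (T := T.1) T.2.dense_domain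
  have h1 := (LinearPMap.isSelfAdjoint_def.1 T.2)
  rw [h1] at h
  exact h x y

theorem norm_addI_sq (T : SelfAdjointOp H) (x : T.1.domain) :
    ‖addI T x‖ ^ 2 = ‖T.1 x‖ ^ 2 + ‖(x : H)‖ ^ 2 := by
  have h := inner_symm T x x
  have h2 : (⟪T.1 x, (x : H)⟫_ℂ).im = 0 := by
    have h3 := inner_conj_symm (𝕜 := ℂ) (T.1 x) (x : H)
    rw [← h] at h3
    exact Complex.conj_eq_iff_im.1 h3
  have e : addI T x = T.1 x + Complex.I • (x : H) := rfl
  rw [e, @norm_add_sq ℂ, inner_smul_right, norm_smul]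
  simp [h2]

theorem norm_subI_sq (T : SelfAdjointOp H) (x : T.1.domain) :
    ‖subI T x‖ ^ 2 = ‖T.1 x‖ ^ 2 + ‖(x : H)‖ ^ 2 := by
  have h := inner_symm T x x
  have h2 : (⟪T.1 x, (x : H)⟫_ℂ).im = 0 := by
    have h3 := inner_conj_symm (𝕜 := ℂ) (T.1 x) (x : H)
    rw [← h] at h3
    exact Complex.conj_eq_iff_im.1 h3
  have e : subI T x = T.1 x - Complex.I • (x : H) := rfl
  rw [e, @norm_sub_sq ℂ, inner_smul_right, norm_smul]
  simp [h2]

theorem addI_bijective (T : SelfAdjointOp H) : Function.Bijective (addI T) := by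
  constructor
  · rw [injective_iff_map_eq_zero]
    intro x hx
    have h := norm_addI_sq T x
    rw [hx] at h
    have h1 : ‖(x : H)‖ = 0 := by
      rw [norm_zero] at h
      nlinarith [sq_nonneg ‖T.1 x‖, sq_nonneg ‖(x : H)‖]
    exact Subtype.ext (norm_eq_zero.1 h1)
  · intro y
    obtain ⟨g, hg, k, hk, hgk⟩ :=
      (graphSubspace T).exists_add_mem_mem_orthogonal (WithLp.toLp 2 ((0 : H), y))
    rw [mem_graphSubspace] at hg
    have hk1 : (k.snd, -k.fst) ∈ T.1.graph := by
      have h1 := LinearPMap.adjoint_graph_eq_graph_adjoint (T := T.1) T.2.dense_domain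
      rw [LinearPMap.isSelfAdjoint_def.1 T.2] at h1
      rw [h1, Submodule.mem_adjoint_iff]
      intro a b hab
      have h2 := hk (WithLp.toLp 2 (a, b)) (mem_graphSubspace.2 hab)
      rw [WithLp.prod_inner_apply] at h2
      simp only [inner_neg_right]
      have h3 : ⟪a, k.fst⟫_ℂ + ⟪b, k.snd⟫_ℂ = 0 := h2
      rw [← h3]; ring
    have hw := T.1.graph.sub_mem hg (T.1.graph.smul_mem Complex.I hk1)
    obtain ⟨w, hw1, hw2⟩ := (LinearPMap.mem_graph_iff _).1 hw
    refine ⟨w, ?_⟩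
    have e : addI T w = T.1 w + Complex.I • (w : H) := rfl
    have f1 : (0 : H) = g.fst + k.fst := congrArg WithLp.fst hgk
    have f2 : y = g.snd + k.snd := congrArg WithLp.snd hgk
    rw [e, hw1, hw2, f2]
    have f3 : g.fst = -k.fst := by rw [eq_neg_iff_add_eq_zero, ← f1]
    simp [f3, smul_sub, smul_smul]

/-- `T + i` as a linear equivalence between the domain of `T` and `H`. -/
def addIEquiv (T : SelfAdjointOp H) : T.1.domain ≃ₗ[ℂ] H :=
  LinearEquiv.ofBijective (addI T) (addI_bijective T)

theorem norm_addIEquiv_symm_sq (T : SelfAdjointOp H) (y : H) :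
    ‖y‖ ^ 2 = ‖T.1 ((addIEquiv T).symm y)‖ ^ 2 + ‖(((addIEquiv T).symm y : T.1.domain) : H)‖ ^ 2 := by
  rw [← norm_addI_sq]
  congr 2
  exact ((addIEquiv T).apply_symm_apply y).symm

/-- The bounded operator `(T + i)⁻¹`. -/
def resolventNegI (T : SelfAdjointOp H) : H →L[ℂ] H :=
  LinearMap.mkContinuous (T.1.domain.subtype ∘ₗ ((addIEquiv T).symm : H →ₗ[ℂ] T.1.domain)) 1
    (by
      intro y
      have h := norm_addIEquiv_symm_sq T y
      rw [one_mul]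
      refine abs_le_of_sq_le_sq' ?_ (norm_nonneg _) |>.2
      rw [h]
      exact le_add_of_nonneg_left (sq_nonneg _))

/-- The Cayley transform `(T - i)(T + i)⁻¹`. -/
def cayley (T : SelfAdjointOp H) : H →L[ℂ] H :=
  LinearMap.mkContinuous (subI T ∘ₗ ((addIEquiv T).symm : H →ₗ[ℂ] T.1.domain)) 1
    (by
      intro y
      have h := norm_addIEquiv_symm_sq T y
      rw [one_mul]
      refine abs_le_of_sq_le_sq' ?_ (norm_nonneg _) |>.2
      rw [h, ← norm_subI_sq]
      exact le_rfl)

/-! ### The winding number and the first definition of the spectral flow -/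

/-- `k(U, ε) = ∑_{0 ≤ θ < ε} dim ker (U - e^{i(π + θ)})`. -/
def eigenvalueCount (U : H →L[ℂ] H) (ε : ℝ) : ℕ :=
  ∑ᶠ θ ∈ Set.Ico (0 : ℝ) ε,
    Module.finrank ℂ (LinearMap.ker
      ((U - Complex.exp (((Real.pi + θ : ℝ) : ℂ) * Complex.I) • (1 : H →L[ℂ] H) : H →L[ℂ] H) :
        H →ₗ[ℂ] H))

/-- A subdivision `0 = t₀ < t₁ < ⋯ < tₙ = 1` of the unit interval with a positive number `ε j` for
each of its segments. -/
structure Subdivision where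
  n : ℕ
  t : Fin (n + 1) → unitInterval
  t_strictMono : StrictMono t
  t_zero : t 0 = 0
  t_last : t (Fin.last n) = 1
  ε : Fin n → ℝ
  ε_pos : ∀ j, 0 < ε j

/-- The segment `[t_{j-1}, t_j]`. -/
def Subdivision.segment (D : Subdivision) (j : Fin D.n) : Set unitInterval :=
  Set.Icc (D.t j.castSucc) (D.t j.succ)

/-- `D` is admissible for the path `u` of unitary operators: along the `j`-th segment the closed arc
`{e^{i(π + θ)} : |θ| ≤ ε j}` does not meet the essential spectrum of `u s`, and its end points are
not eigenvalues of `u s`. -/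
structure Subdivision.IsWinding (D : Subdivision) (u : unitInterval → H →L[ℂ] H) : Prop where
  lt_pi : ∀ j, D.ε j < Real.pi
  isFredholm : ∀ j, ∀ s ∈ D.segment j, ∀ θ : ℝ, |θ| ≤ D.ε j →
    (u s - Complex.exp (((Real.pi + θ : ℝ) : ℂ) * Complex.I) • (1 : H →L[ℂ] H)).IsFredholm
  ker_add : ∀ j, ∀ s ∈ D.segment j,
    LinearMap.ker ((u s - Complex.exp (((Real.pi + D.ε j : ℝ) : ℂ) * Complex.I) •
      (1 : H →L[ℂ] H) : H →L[ℂ] H) : H →ₗ[ℂ] H) = ⊥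
  ker_sub : ∀ j, ∀ s ∈ D.segment j,
    LinearMap.ker ((u s - Complex.exp (((Real.pi - D.ε j : ℝ) : ℂ) * Complex.I) •
      (1 : H →L[ℂ] H) : H →L[ℂ] H) : H →ₗ[ℂ] H) = ⊥

/-- `∑ⱼ (k(u(t_j), ε_j) - k(u(t_{j-1}), ε_j))`. -/
def Subdivision.windingSum (D : Subdivision) (u : unitInterval → H →L[ℂ] H) : ℤ :=
  ∑ j : Fin D.n, ((eigenvalueCount (u (D.t j.succ)) (D.ε j) : ℤ) -
    (eigenvalueCount (u (D.t j.castSucc)) (D.ε j) : ℤ))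

open Classical in
/-- The winding number of a path `u` of unitary operators with `u s + 1` Fredholm, i.e. the net
number of eigenvalues that cross `-1` from the upper into the lower half-plane. It is computed with
some admissible subdivision (and is `0` by convention if there is none). -/
def windingNumber (u : unitInterval → H →L[ℂ] H) : ℤ :=
  if h : ∃ D : Subdivision, D.IsWinding u then h.choose.windingSum u else 0

/-- The Cayley transform of a path of self-adjoint Fredholm operators. -/
def cayleyPath (f : unitInterval → FredholmSA H) : unitInterval → H →L[ℂ] H :=
  fun s => cayley (f s).1

/-- First definition of the spectral flow: the winding number of the Cayley transform. -/
def spectralFlowCayley (f : unitInterval → FredholmSA H) : ℤ :=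
  windingNumber (cayleyPath f)

/-! ### Spectral projections and the second definition of the spectral flow -/

/-- The range of the spectral projection `1_K(T)`, for a compact set `K` of real numbers. With
`R = (T + i)⁻¹`, a bounded normal operator, one has `1_K(T) = 1_L(R)` for the compact set
`L = {(x + i)⁻¹ : x ∈ K}`, and the range of `1_L(R)` consists of the vectors annihilated by `g(R)`
for all continuous functions `g` that vanish on `L`. -/
def spectralSubspace (T : SelfAdjointOp H) (K : Set ℝ) : Submodule ℂ H :=
  ⨅ g : {g : C(ℂ, ℂ) // ∀ x ∈ K, g (((x : ℂ) + Complex.I)⁻¹) = 0},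
    LinearMap.ker ((cfc (fun z => g.1 z) (resolventNegI T) : H →L[ℂ] H) : H →ₗ[ℂ] H)

theorem isClosed_spectralSubspace (T : SelfAdjointOp H) (K : Set ℝ) :
    IsClosed (spectralSubspace T K : Set H) := by
  rw [spectralSubspace, Submodule.coe_iInf]
  exact isClosed_iInter fun g => ContinuousLinearMap.isClosed_ker _

instance (T : SelfAdjointOp H) (K : Set ℝ) : CompleteSpace (spectralSubspace T K) :=
  (isClosed_spectralSubspace T K).completeSpace_coe

/-- The spectral projection `1_K(T)`, for a compact set `K` of real numbers. -/
def spectralProjection (T : SelfAdjointOp H) (K : Set ℝ) : H →L[ℂ] H :=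
  (spectralSubspace T K).starProjection

/-- The range of `E^≥`, where `E` is a spectral projection of `T` with range `M`: the span of the
eigenvectors of `T` in `M` with non-negative eigenvalue. -/
def nonnegPart (T : SelfAdjointOp H) (M : Submodule ℂ H) : Submodule ℂ H :=
  Submodule.span ℂ {x | x ∈ M ∧ ∃ c : ℝ, 0 ≤ c ∧ (x, (c : ℂ) • x) ∈ T.1.graph}

/-- `dim E^≥` for `E = 1_{[-ε, ε]}(T)`. -/
def nonnegDim (T : SelfAdjointOp H) (ε : ℝ) : ℕ :=
  Module.finrank ℂ (nonnegPart T (spectralSubspace T (Set.Icc (-ε) ε)))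

/-- `D` is admissible for the path `f` of self-adjoint Fredholm operators: along the `j`-th segment
`s ↦ 1_{[-ε j, ε j]}(f s)` is continuous in the operator norm and of finite rank. -/
structure Subdivision.IsPhillips (D : Subdivision) (f : unitInterval → FredholmSA H) : Prop where
  continuousOn : ∀ j, ContinuousOn
    (fun s => spectralProjection (f s).1 (Set.Icc (-D.ε j) (D.ε j))) (D.segment j)
  finiteRank : ∀ j, ∀ s ∈ D.segment j,
    FiniteDimensional ℂ (spectralSubspace (f s).1 (Set.Icc (-D.ε j) (D.ε j)))

/-- `∑ⱼ (dim E_j^≥(t_j) - dim E_j^≥(t_{j-1}))`. -/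
def Subdivision.phillipsSum (D : Subdivision) (f : unitInterval → FredholmSA H) : ℤ :=
  ∑ j : Fin D.n, ((nonnegDim (f (D.t j.succ)).1 (D.ε j) : ℤ) -
    (nonnegDim (f (D.t j.castSucc)).1 (D.ε j) : ℤ))

open Classical in
/-- Second definition of the spectral flow, through spectral projections. It is computed with some
admissible subdivision (and is `0` by convention if there is none). -/
def spectralFlowPhillips (f : unitInterval → FredholmSA H) : ℤ :=
  if h : ∃ D : Subdivision, D.IsPhillips f then h.choose.phillipsSum f else 0

end SpectralFlow

end

set_option linter.unusedSectionVars false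

noncomputable section

namespace SpectralFlow

section NormalOperator

variable {H : Type*} [NormedAddCommGroup H] [InnerProductSpace ℂ H] [CompleteSpace H]

/-- The eigenspace of a bounded operator `A` at `z`. -/
def eigspace (A : H →L[ℂ] H) (z : ℂ) : Submodule ℂ H :=
  LinearMap.ker ((A - z • (1 : H →L[ℂ] H) : H →L[ℂ] H) : H →ₗ[ℂ] H)

theorem mem_eigspace {A : H →L[ℂ] H} {z : ℂ} {x : H} : x ∈ eigspace A z ↔ A x = z • x := by
  simp [eigspace, sub_eq_zero]

theorem isClosed_eigspace (A : H →L[ℂ] H) (z : ℂ) : IsClosed (eigspace A z : Set H) :=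
  ContinuousLinearMap.isClosed_ker _

instance (A : H →L[ℂ] H) (z : ℂ) : CompleteSpace (eigspace A z) :=
  (isClosed_eigspace A z).completeSpace_coe

/-- The operator `A - z` is bounded below by `η` on the orthogonal complement of its kernel. -/
def BoundedBelowAt (A : H →L[ℂ] H) (z : ℂ) (η : ℝ) : Prop :=
  ∀ x ∈ (eigspace A z)ᗮ, η * ‖x‖ ≤ ‖A x - z • x‖

theorem exists_boundedBelowAt {A : H →L[ℂ] H} {z : ℂ}
    (h : IsClosed (LinearMap.range ((A - z • (1 : H →L[ℂ] H) : H →L[ℂ] H) : H →ₗ[ℂ] H) : Set H)) :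
    ∃ η > 0, BoundedBelowAt A z η := by
  set B : H →L[ℂ] H := A - z • (1 : H →L[ℂ] H) with hB
  set C : (eigspace A z)ᗮ →L[ℂ] H := B ∘L (eigspace A z)ᗮ.subtypeL with hC
  have hinj : Function.Injective C := by
    rw [injective_iff_map_eq_zero]
    intro x hx
    have h1 : (x : H) ∈ eigspace A z := hx
    have h2 := x.2 _ h1
    exact Subtype.ext (inner_self_eq_zero.1 h2)
  have hrange : Set.range C = Set.range B := by
    apply Set.Subset.antisymm
    · rintro _ ⟨x, rfl⟩
      exact ⟨x, rfl⟩
    · rintro _ ⟨x, rfl⟩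
      obtain ⟨a, ha, b, hb, hab⟩ := (eigspace A z).exists_add_mem_mem_orthogonal x
      refine ⟨⟨b, hb⟩, ?_⟩
      have h1 : B a = 0 := ha
      rw [hab, map_add, h1, zero_add]
      rfl
  have hcl : IsClosed (Set.range C) := by
    rw [hrange]
    exact h
  obtain ⟨K, hK⟩ := C.antilipschitz_of_injective_of_isClosed_range hinj hcl
  refine ⟨((K : ℝ) + 1)⁻¹, by positivity, fun x hx => ?_⟩
  have h1 := hK.le_mul_norm (map_zero C) ⟨x, hx⟩
  have h2 : C ⟨x, hx⟩ = A x - z • x := by simp [hC, hB]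
  rw [h2] at h1
  rw [inv_mul_le_iff₀ (by positivity)]
  exact h1.trans (mul_le_mul_of_nonneg_right (by linarith) (norm_nonneg _))

variable {A : H →L[ℂ] H}

theorem cfc_mul_apply {g h : ℂ → ℂ} (hg : Continuous g) (hh : Continuous h) (x : H) :
    cfc (fun z => g z * h z) A x = cfc g A (cfc h A x) := by
  rw [cfc_mul g h A hg.continuousOn hh.continuousOn]
  rfl

theorem cfc_apply_comm {g h : ℂ → ℂ} (x : H) :
    cfc g A (cfc h A x) = cfc h A (cfc g A x) :=
  congrArg (fun B : H →L[ℂ] H => B x) (cfc_commute_cfc g h A)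

variable [IsStarNormal A]

theorem cfc_apply_self_comm {g : ℂ → ℂ} (x : H) :
    A (cfc g A x) = cfc g A (A x) := by
  have h := cfc_apply_comm (A := A) (g := fun z => z) (h := g) x
  rwa [cfc_id' ℂ A] at h

theorem cfc_sub_const_mul_apply {g : ℂ → ℂ} (hg : Continuous g) (w : ℂ) (x : H) :
    cfc (fun z => (z - w) * g z) A x = A (cfc g A x) - w • cfc g A x := by
  rw [cfc_mul_apply (by fun_prop) hg, cfc_sub (fun z : ℂ => z) (fun _ => w) A, cfc_id' ℂ A,
    cfc_const w A, Algebra.algebraMap_eq_smul_one]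
  rfl

theorem cfc_one_sub_apply {g : ℂ → ℂ} (hg : Continuous g) (x : H) :
    cfc (fun z => 1 - g z) A x = x - cfc g A x := by
  rw [cfc_sub (fun _ : ℂ => (1 : ℂ)) g A (by fun_prop) hg.continuousOn, cfc_const_one ℂ A]
  rfl

theorem cfc_mem_eigspace {g : ℂ → ℂ} {w : ℂ} {x : H} (hx : x ∈ eigspace A w) :
    cfc g A x ∈ eigspace A w := by
  rw [mem_eigspace] at hx ⊢
  rw [cfc_apply_self_comm, hx, map_smul]

theorem norm_cfc_apply_le {g : ℂ → ℂ} {C : ℝ} (hC : 0 ≤ C) (h : ∀ z ∈ spectrum ℂ A, ‖g z‖ ≤ C)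
    (x : H) : ‖cfc g A x‖ ≤ C * ‖x‖ :=
  (ContinuousLinearMap.le_opNorm _ _).trans
    (mul_le_mul_of_nonneg_right (norm_cfc_le hC h) (norm_nonneg _))

theorem inner_cfc_apply {g : ℂ → ℂ} (x y : H) :
    ⟪cfc g A x, y⟫_ℂ = ⟪x, cfc (fun z => star (g z)) A y⟫_ℂ := by
  rw [cfc_star, ContinuousLinearMap.star_eq_adjoint, ContinuousLinearMap.adjoint_inner_right]

theorem cfc_mem_eigspace_orthogonal {g : ℂ → ℂ} {w : ℂ} {x : H} (hx : x ∈ (eigspace A w)ᗮ) :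
    cfc g A x ∈ (eigspace A w)ᗮ := by
  intro y hy
  have h := inner_cfc_apply (A := A) (g := fun z => star (g z)) y x
  simp only [star_star] at h
  rw [← h]
  exact hx _ (cfc_mem_eigspace hy)

theorem norm_cfc_apply_eq {g h : ℂ → ℂ} (hg : Continuous g) (hh : Continuous h)
    (hgh : ∀ z, ‖g z‖ = ‖h z‖) (x : H) : ‖cfc g A x‖ = ‖cfc h A x‖ := by
  have key : ∀ k : ℂ → ℂ, Continuous k →
      ⟪cfc k A x, cfc k A x⟫_ℂ = ⟪x, cfc (fun z => ((‖k z‖ ^ 2 : ℝ) : ℂ)) A x⟫_ℂ := by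
    intro k hk
    rw [inner_cfc_apply, ← cfc_mul_apply (by fun_prop) hk]
    congr 3
    ext z
    have h := RCLike.conj_mul (k z)
    rw [Complex.ofReal_pow]
    exact h
  have e : ⟪cfc g A x, cfc g A x⟫_ℂ = ⟪cfc h A x, cfc h A x⟫_ℂ := by
    rw [key g hg, key h hh]
    simp only [hgh]
  rw [inner_self_eq_norm_sq_to_K, inner_self_eq_norm_sq_to_K] at e
  have e2 : ‖cfc g A x‖ ^ 2 = ‖cfc h A x‖ ^ 2 := by exact_mod_cast e
  exact (sq_eq_sq₀ (norm_nonneg _) (norm_nonneg _)).1 e2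

/-- The functional calculus on an eigenvector. -/
theorem cfc_apply_of_mem_eigspace {g : ℂ → ℂ} (hg : Continuous g) {w : ℂ} {x : H}
    (hx : x ∈ eigspace A w) : cfc g A x = g w • x := by
  have hdist : cfc (fun z => ((‖z - w‖ : ℝ) : ℂ)) A x = 0 := by
    rw [← norm_eq_zero, norm_cfc_apply_eq (h := fun z => (z - w) * 1) (by fun_prop) (by fun_prop)
      (fun z => by simp), cfc_sub_const_mul_apply continuous_const, cfc_const_one ℂ A]
    simp [mem_eigspace.1 hx]
  rw [← sub_eq_zero, ← norm_le_zero_iff]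
  refine le_of_forall_pos_le_add fun e he => ?_
  set e' := e / (‖x‖ + 1) with he'
  have he'0 : 0 < e' := by positivity
  obtain ⟨r, hr, hball⟩ := Metric.continuous_iff.1 hg w e' he'0
  obtain ⟨M, hM⟩ := (spectrum.isCompact (𝕜 := ℂ) A).exists_bound_of_continuousOn
    (f := fun z => g z - g w) (by fun_prop)
  set C := |M| / (e' * r) with hC
  have hpos : ∀ z : ℂ, 0 < 1 + C * ‖z - w‖ := fun z => by positivity
  set k : ℂ → ℂ := fun z => (g z - g w) * ((1 + C * ‖z - w‖ : ℝ) : ℂ)⁻¹ with hk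
  have hkc : Continuous k := by
    have h4 : Continuous fun z : ℂ => ((1 + C * ‖z - w‖ : ℝ) : ℂ) := by fun_prop
    exact (hg.sub continuous_const).mul (h4.inv₀ fun z => by exact_mod_cast (hpos z).ne')
  have e1 : cfc g A x - g w • x = cfc k A x := by
    have h1 : cfc (fun z => g z - g w) A x = cfc g A x - g w • x := by
      rw [cfc_sub g (fun _ => g w) A hg.continuousOn, cfc_const (g w) A,
        Algebra.algebraMap_eq_smul_one]
      rfl
    have h2 : (fun z => g z - g w) = fun z => k z * (1 + C * ((‖z - w‖ : ℝ) : ℂ)) := by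
      ext z
      have := (hpos z).ne'
      have h3 : (1 + C * ((‖z - w‖ : ℝ) : ℂ)) ≠ 0 := by exact_mod_cast this
      simp only [hk]
      push_cast
      field_simp
    rw [← h1, h2, cfc_mul_apply hkc (by fun_prop)]
    congr 1
    rw [cfc_add A (fun _ : ℂ => (1 : ℂ)) (fun z : ℂ => C * ((‖z - w‖ : ℝ) : ℂ)),
      cfc_const_one ℂ A, cfc_const_mul (C : ℂ) (fun z : ℂ => ((‖z - w‖ : ℝ) : ℂ)) A]
    simp [hdist]
  rw [e1, zero_add]
  have h6 : ∀ z ∈ spectrum ℂ A, ‖k z‖ ≤ e' := by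
    intro z hz
    rw [hk]
    simp only [norm_mul, norm_inv, Complex.norm_real, Real.norm_of_nonneg (hpos z).le]
    rw [mul_inv_le_iff₀ (hpos z)]
    by_cases hzr : ‖z - w‖ < r
    · have := hball z (by rwa [dist_eq_norm])
      rw [dist_eq_norm] at this
      have h7 : 0 ≤ e' * (C * ‖z - w‖) := by positivity
      nlinarith
    · have h8 := (hM z hz).trans (le_abs_self M)
      have h9 : e' * (C * ‖z - w‖) = |M| * (‖z - w‖ / r) := by
        rw [hC]; field_simp
      have h10 : 1 ≤ ‖z - w‖ / r := by rw [le_div_iff₀ hr]; linarith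
      nlinarith [abs_nonneg M]
  refine (norm_cfc_apply_le he'0.le h6 x).trans ?_
  rw [he', div_mul_eq_mul_div, div_le_iff₀ (by positivity)]
  nlinarith [norm_nonneg x]

theorem apply_cfc_of_boundedBelowAt {w : ℂ} {η η' : ℝ} (hA : BoundedBelowAt A w η)
    (hη : η' < η) (hη0 : 0 < η') {g : ℂ → ℂ} (hg : Continuous g)
    (hsupp : ∀ z, g z ≠ 0 → ‖z - w‖ ≤ η') (x : H) : cfc g A x ∈ eigspace A w := by
  obtain ⟨a, ha, b, hb, rfl⟩ := (eigspace A w).exists_add_mem_mem_orthogonal x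
  rw [map_add]
  refine add_mem (cfc_mem_eigspace ha) ?_
  suffices h : cfc g A b = 0 by rw [h]; exact zero_mem _
  set y := cfc g A b with hy
  have hy1 : η * ‖y‖ ≤ ‖A y - w • y‖ := hA y (cfc_mem_eigspace_orthogonal hb)
  set p : ℂ → ℂ := fun z => ((η' / max η' ‖z - w‖ : ℝ) : ℂ) with hp
  have hmax : ∀ z : ℂ, 0 < max η' ‖z - w‖ := fun z => lt_of_lt_of_le hη0 (le_max_left _ _)
  have hpc : Continuous p := by
    have h4 : Continuous fun z : ℂ => max η' ‖z - w‖ := by fun_prop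
    exact Complex.continuous_ofReal.comp (continuous_const.div h4 fun z => (hmax z).ne')
  have hpy : cfc p A y = y := by
    rw [hy, ← cfc_mul_apply hpc hg]
    congr 2
    ext z
    by_cases hz : g z = 0
    · simp [hz]
    · have : p z = 1 := by
        simp only [hp, max_eq_left (hsupp z hz), div_self hη0.ne', Complex.ofReal_one]
      rw [this, one_mul]
  have h2 : ‖A y - w • y‖ ≤ η' * ‖y‖ := by
    have h3 : A y - w • y = cfc (fun z => (z - w) * p z) A y := by
      rw [cfc_sub_const_mul_apply hpc, hpy]
    rw [h3]
    refine norm_cfc_apply_le hη0.le (fun z _ => ?_) y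
    rw [norm_mul, hp]
    simp only [Complex.norm_real]
    rw [Real.norm_of_nonneg (div_nonneg hη0.le (hmax z).le), mul_div_assoc', div_le_iff₀ (hmax z),
      mul_comm]
    exact mul_le_mul_of_nonneg_left (le_max_right _ _) hη0.le
  rw [← norm_le_zero_iff]
  by_contra hcon
  push Not at hcon
  nlinarith

/-- A continuous bump function around `w`. -/
def bump (w : ℂ) (r : ℝ) (z : ℂ) : ℂ := ((max 0 (r - ‖z - w‖) : ℝ) : ℂ)

theorem continuous_bump (w : ℂ) (r : ℝ) : Continuous (bump w r) := by
  unfold bump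
  fun_prop

theorem bump_ne_zero_iff {w z : ℂ} {r : ℝ} : bump w r z ≠ 0 ↔ ‖z - w‖ < r := by
  simp [bump]

theorem exists_cfc_bump_apply_ne_zero {w : ℂ} (hw : w ∈ spectrum ℂ A) {r : ℝ} (hr : 0 < r) :
    ∃ x, cfc (bump w r) A x ≠ 0 := by
  by_contra! hcon
  have h1 : cfc (bump w r) A = 0 := by
    ext x
    exact hcon x
  have h2 := norm_apply_le_norm_cfc (bump w r) A hw (continuous_bump w r).continuousOn
  rw [h1, norm_zero, norm_le_zero_iff] at h2
  exact bump_ne_zero_iff.2 (by simpa using hr) h2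

/-- The spectrum near a point at which a normal operator is bounded below off its kernel. -/
theorem eq_of_mem_spectrum_of_boundedBelowAt {w : ℂ} {η : ℝ} (hA : BoundedBelowAt A w η)
    {z : ℂ} (hz : z ∈ spectrum ℂ A) (hzw : ‖z - w‖ < η) : z = w := by
  by_contra hne
  have h0 : 0 < ‖z - w‖ := norm_pos_iff.2 (sub_ne_zero.2 hne)
  set r := min ((η - ‖z - w‖) / 2) (‖z - w‖) with hr
  have hr0 : 0 < r := lt_min (by linarith) h0
  obtain ⟨x, hx⟩ := exists_cfc_bump_apply_ne_zero hz hr0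
  have hmem : ∀ x, cfc (bump z r) A x ∈ eigspace A w := by
    refine apply_cfc_of_boundedBelowAt hA (η' := (η + ‖z - w‖) / 2) (by linarith) (by linarith)
      (continuous_bump z r) fun u hu => ?_
    rw [bump_ne_zero_iff] at hu
    have h1 : ‖u - w‖ ≤ ‖u - z‖ + ‖z - w‖ := norm_sub_le_norm_sub_add_norm_sub _ _ _
    have h2 : r ≤ (η - ‖z - w‖) / 2 := min_le_left _ _
    linarith
  have hzero : bump z r w = 0 := by
    by_contra h
    rw [← ne_eq, bump_ne_zero_iff, norm_sub_rev] at h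
    exact absurd h (not_lt.2 (min_le_right _ _))
  have h3 : ∀ y, cfc (fun u => bump z r u * bump z r u) A y = 0 := fun y => by
    rw [cfc_mul_apply (continuous_bump z r) (continuous_bump z r),
      cfc_apply_of_mem_eigspace (continuous_bump z r) (hmem y), hzero, zero_smul]
  apply hx
  rw [← inner_self_eq_zero (𝕜 := ℂ), inner_cfc_apply]
  have h5 : (fun u => star (bump z r u)) = bump z r := by
    ext u
    simp [bump]
  rw [h5, ← cfc_mul_apply (continuous_bump z r) (continuous_bump z r), h3, inner_zero_right]

theorem notMem_spectrum_of_boundedBelowAt {w : ℂ} {η : ℝ} (hη : 0 < η)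
    (hA : BoundedBelowAt A w η) (hker : eigspace A w = ⊥) : w ∉ spectrum ℂ A := by
  intro hw
  obtain ⟨x, hx⟩ := exists_cfc_bump_apply_ne_zero hw (half_pos hη)
  have h := apply_cfc_of_boundedBelowAt hA (half_lt_self hη) (half_pos hη)
    (continuous_bump w (η / 2)) (fun u hu => (bump_ne_zero_iff.1 hu).le) x
  rw [hker] at h
  exact hx h

theorem eigspace_eq_bot_of_notMem_spectrum {w : ℂ} (hw : w ∉ spectrum ℂ A) :
    eigspace A w = ⊥ := by
  rw [eq_bot_iff]
  intro x hx
  rw [spectrum.notMem_iff] at hw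
  obtain ⟨u, hu⟩ := hw
  have h1 : (u : H →L[ℂ] H) x = 0 := by
    rw [hu, Algebra.algebraMap_eq_smul_one]
    simp [mem_eigspace.1 hx]
  have h2 : ((↑u⁻¹ : H →L[ℂ] H) * (u : H →L[ℂ] H)) x = x := by simp
  have h3 : ((↑u⁻¹ : H →L[ℂ] H) * (u : H →L[ℂ] H)) x = (↑u⁻¹ : H →L[ℂ] H) ((u : H →L[ℂ] H) x) := rfl
  rw [h3, h1, map_zero] at h2
  exact h2.symm

end NormalOperator

section Rank

variable {H : Type*} [NormedAddCommGroup H] [InnerProductSpace ℂ H]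

theorem injective_restrict_of_norm_sub_lt_one {P Q : H →L[ℂ] H} {V W : Submodule ℂ H}
    (hP : ∀ x ∈ V, P x = x) (hQ : ∀ x, Q x ∈ W) (hPQ : ‖P - Q‖ < 1) :
    Function.Injective (((Q : H →ₗ[ℂ] H).codRestrict W hQ).domRestrict V) := by
  rw [injective_iff_map_eq_zero]
  intro x hx
  have h1 : Q x = 0 := congrArg Subtype.val hx
  have h2 : ‖(P - Q) x‖ ≤ ‖P - Q‖ * ‖(x : H)‖ := ContinuousLinearMap.le_opNorm _ _
  rw [sub_apply, h1, hP x x.2, sub_zero] at h2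
  refine Subtype.ext (norm_le_zero_iff.1 ?_)
  by_contra hcon
  push Not at hcon
  nlinarith

theorem finrank_eq_of_norm_sub_lt_one {P Q : H →L[ℂ] H} {V W : Submodule ℂ H}
    [FiniteDimensional ℂ V] [FiniteDimensional ℂ W]
    (hP : ∀ x ∈ V, P x = x) (hP' : ∀ x, P x ∈ V) (hQ : ∀ x ∈ W, Q x = x) (hQ' : ∀ x, Q x ∈ W)
    (hPQ : ‖P - Q‖ < 1) : Module.finrank ℂ V = Module.finrank ℂ W :=
  le_antisymm
    (LinearMap.finrank_le_finrank_of_injective (injective_restrict_of_norm_sub_lt_one hP hQ' hPQ))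
    (LinearMap.finrank_le_finrank_of_injective
      (injective_restrict_of_norm_sub_lt_one hQ hP' (by rwa [norm_sub_rev])))

/-- An operator that is invertible modulo an operator of finite rank is Fredholm. -/
theorem isFredholm_of_mul_eq_one_sub {B S F : H →L[ℂ] H} {W : Submodule ℂ H}
    [FiniteDimensional ℂ W] (hF : ∀ x, F x ∈ W) (h1 : ∀ x, S (B x) = x - F x)
    (h2 : ∀ x, B (S x) = x - F x) : B.IsFredholm := by
  have key : ∀ C : H →ₗ[ℂ] H, (∀ x, C x = x - F x) → (C - LinearMap.id).HasNoetherianRange := by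
    intro C hC
    rw [LinearMap.hasNoetherianRange_iff_range]
    have : LinearMap.range (C - LinearMap.id) ≤ W := by
      rintro _ ⟨x, rfl⟩
      simp [hC, hF]
    exact isNoetherian_of_le this
  exact ContinuousLinearMap.IsFredholm.of_isQuasiInverse (v := S)
    ⟨LinearMap.FiniteRangeSetoid.equiv_iff_hasNoetherianRange.2 (key _ h1),
      LinearMap.FiniteRangeSetoid.equiv_iff_hasNoetherianRange.2 (key _ h2)⟩

end Rank

section SelfAdjoint

variable {H : Type*} [NormedAddCommGroup H] [InnerProductSpace ℂ H] [CompleteSpace H]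

theorem addI_apply (T : SelfAdjointOp H) (x : T.1.domain) :
    addI T x = T.1 x + Complex.I • (x : H) := rfl

theorem subI_apply (T : SelfAdjointOp H) (x : T.1.domain) :
    subI T x = T.1 x - Complex.I • (x : H) := rfl

theorem resolventNegI_addI (T : SelfAdjointOp H) (x : T.1.domain) :
    resolventNegI T (addI T x) = x := by
  have h : (addIEquiv T).symm (addI T x) = x := (addIEquiv T).symm_apply_apply x
  change (((addIEquiv T).symm (addI T x) : T.1.domain) : H) = x
  rw [h]

theorem cayley_addI (T : SelfAdjointOp H) (x : T.1.domain) :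
    cayley T (addI T x) = subI T x := by
  have h : (addIEquiv T).symm (addI T x) = x := (addIEquiv T).symm_apply_apply x
  change subI T ((addIEquiv T).symm (addI T x)) = subI T x
  rw [h]

theorem cayley_eq (T : SelfAdjointOp H) :
    cayley T = 1 - (2 * Complex.I) • resolventNegI T := by
  ext y
  obtain ⟨x, rfl⟩ := (addI_bijective T).2 y
  rw [cayley_addI, sub_apply, one_apply_eq_self, smul_apply, resolventNegI_addI, addI_apply,
    subI_apply]
  module

theorem snd_neg_fst_mem_graph (T : SelfAdjointOp H) {k : WithLp 2 (H × H)}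
    (hk : k ∈ (graphSubspace T)ᗮ) : (k.snd, -k.fst) ∈ T.1.graph := by
  have h1 := LinearPMap.adjoint_graph_eq_graph_adjoint (T := T.1) T.2.dense_domain
  rw [LinearPMap.isSelfAdjoint_def.1 T.2] at h1
  rw [h1, Submodule.mem_adjoint_iff]
  intro a b hab
  have h2 := hk (WithLp.toLp 2 (a, b)) (mem_graphSubspace.2 hab)
  rw [WithLp.prod_inner_apply] at h2
  simp only [inner_neg_right]
  have h3 : ⟪a, k.fst⟫_ℂ + ⟪b, k.snd⟫_ℂ = 0 := h2
  rw [← h3]; ring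

theorem subI_surjective (T : SelfAdjointOp H) : Function.Surjective (subI T) := by
  intro y
  obtain ⟨g, hg, k, hk, hgk⟩ :=
    (graphSubspace T).exists_add_mem_mem_orthogonal (WithLp.toLp 2 ((0 : H), y))
  rw [mem_graphSubspace] at hg
  have hk1 := snd_neg_fst_mem_graph T hk
  have hw := T.1.graph.add_mem hg (T.1.graph.smul_mem Complex.I hk1)
  obtain ⟨w, hw1, hw2⟩ := (LinearPMap.mem_graph_iff _).1 hw
  refine ⟨w, ?_⟩
  have f1 : (0 : H) = g.fst + k.fst := congrArg WithLp.fst hgk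
  have f2 : y = g.snd + k.snd := congrArg WithLp.snd hgk
  rw [subI_apply, hw1, hw2, f2]
  have f3 : g.fst = -k.fst := by rw [eq_neg_iff_add_eq_zero, ← f1]
  simp only [f3, Prod.smul_mk, Prod.mk_add_mk, smul_add, smul_neg, smul_smul, Complex.I_mul_I]
  module

theorem resolventNegI_eq_graphProjection (T : SelfAdjointOp H) (y : H) :
    resolventNegI T y = (graphProjection T (WithLp.toLp 2 ((0 : H), y))).fst -
      Complex.I • (y - (graphProjection T (WithLp.toLp 2 ((0 : H), y))).snd) := by
  set v : WithLp 2 (H × H) := WithLp.toLp 2 ((0 : H), y) with hv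
  set g := graphProjection T v with hgdef
  have hg : g ∈ graphSubspace T := (graphSubspace T).starProjection_apply_mem v
  have hk : v - g ∈ (graphSubspace T)ᗮ := (graphSubspace T).sub_starProjection_mem_orthogonal v
  rw [mem_graphSubspace] at hg
  have hk1 := snd_neg_fst_mem_graph T hk
  have e1 : (v - g).snd = y - g.snd := rfl
  have e2 : (v - g).fst = 0 - g.fst := rfl
  rw [e1, e2] at hk1
  have hw := T.1.graph.sub_mem hg (T.1.graph.smul_mem Complex.I hk1)
  obtain ⟨w, hw1, hw2⟩ := (LinearPMap.mem_graph_iff _).1 hw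
  have h3 : addI T w = y := by
    rw [addI_apply, hw1, hw2]
    simp [smul_sub, smul_smul]
  rw [← h3, resolventNegI_addI, hw1, h3]
  rfl

theorem continuous_resolventNegI :
    Continuous (resolventNegI : SelfAdjointOp H → H →L[ℂ] H) := by
  have hP : Continuous (graphProjection : SelfAdjointOp H → _) := continuous_induced_dom
  set J : H →L[ℂ] WithLp 2 (H × H) :=
    ((WithLp.prodContinuousLinearEquiv 2 ℂ H H).symm : H × H →L[ℂ] WithLp 2 (H × H)) ∘L
      ContinuousLinearMap.inr ℂ H H with hJ
  set F : WithLp 2 (H × H) →L[ℂ] H := ContinuousLinearMap.fst ℂ H H ∘L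
    (WithLp.prodContinuousLinearEquiv 2 ℂ H H : WithLp 2 (H × H) →L[ℂ] H × H) with hF
  set S : WithLp 2 (H × H) →L[ℂ] H := ContinuousLinearMap.snd ℂ H H ∘L
    (WithLp.prodContinuousLinearEquiv 2 ℂ H H : WithLp 2 (H × H) →L[ℂ] H × H) with hS
  have h : (resolventNegI : SelfAdjointOp H → H →L[ℂ] H) = fun T =>
      F ∘L graphProjection T ∘L J - Complex.I • (1 - S ∘L graphProjection T ∘L J) := by
    ext T y
    rw [resolventNegI_eq_graphProjection]
    rfl
  rw [h]
  fun_prop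

theorem norm_cayley_apply (T : SelfAdjointOp H) (y : H) : ‖cayley T y‖ = ‖y‖ := by
  obtain ⟨x, rfl⟩ := (addI_bijective T).2 y
  rw [cayley_addI, ← sq_eq_sq₀ (norm_nonneg _) (norm_nonneg _), norm_addI_sq, norm_subI_sq]

theorem cayley_mem_unitary (T : SelfAdjointOp H) : cayley T ∈ unitary (H →L[ℂ] H) := by
  have hs : Function.Surjective (cayley T) := by
    intro y
    obtain ⟨x, rfl⟩ := subI_surjective T y
    exact ⟨_, cayley_addI T x⟩
  let e : H ≃ₗᵢ[ℂ] H := LinearIsometryEquiv.ofSurjective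
    ⟨(cayley T : H →ₗ[ℂ] H), norm_cayley_apply T⟩ hs
  have h : cayley T = (Unitary.linearIsometryEquiv.symm e : H →L[ℂ] H) := by
    ext x
    rfl
  rw [h]
  exact (Unitary.linearIsometryEquiv.symm e).2

theorem resolventNegI_eq (T : SelfAdjointOp H) :
    resolventNegI T = (2 * Complex.I)⁻¹ • (1 - cayley T) := by
  rw [cayley_eq, sub_sub_cancel, smul_smul, inv_mul_cancel₀ (by simp), one_smul]

instance (T : SelfAdjointOp H) : IsStarNormal (cayley T) :=
  Unitary.coe_isStarNormal ⟨_, cayley_mem_unitary T⟩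

instance (T : SelfAdjointOp H) : IsStarNormal (resolventNegI T) := by
  have h : IsStarNormal (cfc (fun z : ℂ => (2 * Complex.I)⁻¹ * (1 - z)) (cayley T)) :=
    cfc_predicate _ _
  rw [cfc_const_mul _ (fun z : ℂ => 1 - z), cfc_sub (fun _ : ℂ => 1) (fun z : ℂ => z),
    cfc_const_one ℂ (cayley T), cfc_id' ℂ (cayley T), ← resolventNegI_eq] at h
  exact h

/-- The point of the spectrum of `(T + i)⁻¹` that corresponds to the real number `c`. -/
def cz (c : ℝ) : ℂ := ((c : ℂ) + Complex.I)⁻¹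

theorem add_I_ne_zero (c : ℝ) : (c : ℂ) + Complex.I ≠ 0 := by
  intro h
  simpa using congrArg Complex.im h

theorem cz_mul (c : ℝ) : cz c * ((c : ℂ) + Complex.I) = 1 :=
  inv_mul_cancel₀ (add_I_ne_zero c)

theorem cz_injective : Function.Injective cz := fun c d h => by
  have := inv_injective h
  simpa using this

theorem continuous_cz : Continuous cz := by
  unfold cz
  exact (by fun_prop : Continuous fun c : ℝ => (c : ℂ) + Complex.I).inv₀ add_I_ne_zero

theorem normSq_add_I (c : ℝ) : Complex.normSq ((c : ℂ) + Complex.I) = c ^ 2 + 1 := by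
  simp [Complex.normSq_apply, sq]

theorem cz_re (c : ℝ) : (cz c).re = c / (c ^ 2 + 1) := by
  rw [cz, Complex.inv_re, normSq_add_I]
  simp

theorem norm_cz_sq (c : ℝ) : ‖cz c‖ ^ 2 = 1 / (c ^ 2 + 1) := by
  rw [cz, norm_inv, inv_pow, ← Complex.normSq_eq_norm_sq, normSq_add_I, one_div]

theorem norm_cz_add_I (c : ℝ) : ‖cz c + Complex.I‖ = Real.sqrt (c ^ 2 / (c ^ 2 + 1)) := by
  have h : cz c + Complex.I = Complex.I * c * cz c := by
    have := cz_mul c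
    linear_combination (-Complex.I) * this + cz c * Complex.I_sq
  rw [h, norm_mul, norm_mul, Complex.norm_I, one_mul, Complex.norm_real, Real.norm_eq_abs]
  rw [← sq_eq_sq₀ (by positivity) (by positivity), mul_pow, norm_cz_sq, Real.sq_sqrt (by positivity),
    sq_abs]
  ring

/-- The distance from `(0 + i)⁻¹` to `(c + i)⁻¹`. -/
def rad (c : ℝ) : ℝ := ‖cz c + Complex.I‖

theorem rad_lt_one (c : ℝ) : rad c < 1 := by
  rw [rad, norm_cz_add_I, Real.sqrt_lt' one_pos, div_lt_iff₀ (by positivity)]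
  linarith

theorem rad_lt_rad {c d : ℝ} (h : |c| < |d|) : rad c < rad d := by
  rw [rad, rad, norm_cz_add_I, norm_cz_add_I]
  apply Real.sqrt_lt_sqrt (by positivity)
  rw [div_lt_div_iff₀ (by positivity) (by positivity)]
  have := sq_lt_sq.2 h
  nlinarith

theorem rad_lt_rad_iff {c d : ℝ} : rad c < rad d ↔ |c| < |d| := by
  refine ⟨fun h => ?_, rad_lt_rad⟩
  by_contra hcon
  push Not at hcon
  rcases hcon.lt_or_eq with h1 | h1
  · exact absurd (rad_lt_rad h1) (not_lt.2 h.le)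
  · have : rad c = rad d := by
      rw [rad, rad, norm_cz_add_I, norm_cz_add_I, sq_eq_sq_iff_abs_eq_abs _ _ |>.2 h1]
    exact absurd this h.ne

theorem rad_le_rad_iff {c d : ℝ} : rad c ≤ rad d ↔ |c| ≤ |d| := by
  rw [← not_lt, rad_lt_rad_iff, not_lt]

theorem rad_eq_rad_iff {c d : ℝ} : rad c = rad d ↔ |c| = |d| := by
  rw [le_antisymm_iff, rad_le_rad_iff, rad_le_rad_iff, ← le_antisymm_iff]

theorem rad_zero : rad 0 = 0 := by
  rw [rad, norm_cz_add_I]; simp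

theorem continuous_rad : Continuous rad := by
  unfold rad
  have := continuous_cz
  fun_prop

theorem cz_zero : cz 0 = -Complex.I := by simp [cz]

theorem spectrum_resolventNegI (T : SelfAdjointOp H) {z : ℂ}
    (hz : z ∈ spectrum ℂ (resolventNegI T)) : z = 0 ∨ ∃ c, z = cz c := by
  have h1 : cayley T = cfc (fun z : ℂ => 1 - (2 * Complex.I) * z) (resolventNegI T) := by
    rw [cfc_sub (fun _ : ℂ => 1) (fun z : ℂ => (2 * Complex.I) * z),
      cfc_const_mul _ (fun z : ℂ => z), cfc_const_one ℂ (resolventNegI T),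
      cfc_id' ℂ (resolventNegI T), cayley_eq]
  have h2 : 1 - (2 * Complex.I) * z ∈ spectrum ℂ (cayley T) := by
    rw [h1, cfc_map_spectrum (R := ℂ) (fun z : ℂ => 1 - (2 * Complex.I) * z) (resolventNegI T)]
    exact ⟨z, hz, rfl⟩
  have h3 : ‖1 - (2 * Complex.I) * z‖ = 1 := by
    have := spectrum.subset_circle_of_unitary (cayley_mem_unitary T) h2
    simpa using this
  rw [or_iff_not_imp_left]
  intro hz0
  refine ⟨(z⁻¹).re, ?_⟩
  have h4 : (z⁻¹).im = 1 := by
    have h5 : z.re ^ 2 + z.im ^ 2 = - z.im := by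
      have h6 := congrArg (fun r : ℝ => r ^ 2) h3
      simp only [← Complex.normSq_eq_norm_sq, Complex.normSq_apply] at h6
      simp at h6
      nlinarith
    rw [Complex.inv_im, Complex.normSq_apply, ← sq, ← sq, h5, div_self]
    rw [← h5]
    intro h7
    apply hz0
    have h8 : z.re = 0 := by nlinarith [sq_nonneg z.re, sq_nonneg z.im]
    have h9 : z.im = 0 := by nlinarith [sq_nonneg z.re, sq_nonneg z.im]
    exact Complex.ext h8 h9
  have h5 : ((z⁻¹).re : ℂ) + Complex.I = z⁻¹ := by
    apply Complex.ext <;> simp [h4]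
  rw [cz, h5, inv_inv]

theorem mem_eigspace_resolventNegI {T : SelfAdjointOp H} {c : ℝ} {x : H} :
    x ∈ eigspace (resolventNegI T) (cz c) ↔ (x, (c : ℂ) • x) ∈ T.1.graph := by
  rw [mem_eigspace]
  constructor
  · intro h
    obtain ⟨w, hw⟩ := (addI_bijective T).2 x
    have h1 : (w : H) = cz c • x := by
      rw [← h, ← hw, resolventNegI_addI]
    have h2 : x = ((c : ℂ) + Complex.I) • (w : H) := by
      rw [h1, smul_smul, mul_comm, cz_mul, one_smul]
    have h3 : T.1 w = (c : ℂ) • (w : H) := by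
      have h4 := hw
      rw [addI_apply] at h4
      have h5 : T.1 w = x - Complex.I • (w : H) := by rw [← h4]; abel
      rw [h5, h2]
      module
    have h6 : ((w : H), (c : ℂ) • (w : H)) ∈ T.1.graph := by
      rw [← h3]
      exact T.1.mem_graph w
    have h7 := T.1.graph.smul_mem ((c : ℂ) + Complex.I) h6
    rw [Prod.smul_mk, smul_comm, ← h2] at h7
    exact h7
  · intro h
    obtain ⟨w, hw1, hw2⟩ := (LinearPMap.mem_graph_iff _).1 h
    have h1 : addI T w = ((c : ℂ) + Complex.I) • x := by
      rw [addI_apply, hw1, hw2]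
      module
    have h2 := resolventNegI_addI T w
    rw [h1, map_smul, hw1] at h2
    simp only at h2
    nth_rewrite 2 [← h2]
    rw [smul_smul, cz_mul, one_smul]

end SelfAdjoint

section SpectralSubspace

variable {H : Type*} [NormedAddCommGroup H] [InnerProductSpace ℂ H] [CompleteSpace H]

theorem mem_spectralSubspace {T : SelfAdjointOp H} {K : Set ℝ} {x : H} :
    x ∈ spectralSubspace T K ↔ ∀ g : ℂ → ℂ, Continuous g → (∀ c ∈ K, g (cz c) = 0) →
      cfc g (resolventNegI T) x = 0 := by
  rw [spectralSubspace, Submodule.mem_iInf]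
  constructor
  · intro h g hg hK
    exact h ⟨⟨g, hg⟩, hK⟩
  · rintro h ⟨g, hK⟩
    exact h g g.continuous hK

theorem cfc_mem_spectralSubspace {T : SelfAdjointOp H} {K : Set ℝ} {x : H} (g : ℂ → ℂ)
    (hx : x ∈ spectralSubspace T K) : cfc g (resolventNegI T) x ∈ spectralSubspace T K := by
  rw [mem_spectralSubspace] at hx ⊢
  intro h hh hK
  rw [cfc_apply_comm, hx h hh hK, map_zero]

theorem eigspace_le_spectralSubspace (T : SelfAdjointOp H) {K : Set ℝ} {c : ℝ} (hc : c ∈ K) :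
    eigspace (resolventNegI T) (cz c) ≤ spectralSubspace T K := by
  intro x hx
  rw [mem_spectralSubspace]
  intro g hg hK
  rw [cfc_apply_of_mem_eigspace hg hx, hK c hc, zero_smul]

theorem cfc_apply_mem_spectralSubspace {T : SelfAdjointOp H} {K : Set ℝ} {g : ℂ → ℂ}
    (hg : Continuous g)
    (hK : ∀ z ∈ spectrum ℂ (resolventNegI T), g z ≠ 0 → ∃ c ∈ K, z = cz c) (x : H) :
    cfc g (resolventNegI T) x ∈ spectralSubspace T K := by
  rw [mem_spectralSubspace]
  intro h hh hhK
  rw [← cfc_mul_apply hh hg, cfc_congr (g := fun _ => (0 : ℂ)), cfc_const_zero]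
  · rfl
  · intro z hz
    by_cases hgz : g z = 0
    · simp [hgz]
    · obtain ⟨c, hc, rfl⟩ := hK z hz hgz
      simp [hhK c hc]

theorem cfc_apply_of_mem_spectralSubspace {T : SelfAdjointOp H} {K : Set ℝ} {g : ℂ → ℂ}
    (hg : Continuous g) (hK : ∀ c ∈ K, g (cz c) = 1) {x : H} (hx : x ∈ spectralSubspace T K) :
    cfc g (resolventNegI T) x = x := by
  have h := mem_spectralSubspace.1 hx (fun z => 1 - g z) (by fun_prop)
    (fun c hc => by simp [hK c hc])
  rw [cfc_one_sub_apply hg, sub_eq_zero] at h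
  exact h.symm

/-- A continuous function that vanishes exactly on the image of `[-ε, ε]`, among the points of the
spectrum. -/
def outside (ε : ℝ) (z : ℂ) : ℂ := ((max 0 (‖z + Complex.I‖ - rad ε) : ℝ) : ℂ)

theorem continuous_outside (ε : ℝ) : Continuous (outside ε) := by
  unfold outside
  fun_prop

theorem outside_cz_eq_zero_iff {ε c : ℝ} : outside ε (cz c) = 0 ↔ |c| ≤ |ε| := by
  rw [outside, ← rad_le_rad_iff]
  simp [rad]

theorem star_outside (ε : ℝ) (z : ℂ) : star (outside ε z) = outside ε z := by
  simp [outside]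

theorem outside_eq_zero_of_mem_Icc {ε c : ℝ} (hc : c ∈ Set.Icc (-ε) ε) :
    outside ε (cz c) = 0 :=
  outside_cz_eq_zero_iff.2 ((abs_le.2 hc).trans (le_abs_self _))

theorem mem_Icc_of_mem_eigspace {T : SelfAdjointOp H} {ε c : ℝ} (hε : 0 ≤ ε) {x : H} (hx0 : x ≠ 0)
    (hx : x ∈ spectralSubspace T (Set.Icc (-ε) ε))
    (hxc : x ∈ eigspace (resolventNegI T) (cz c)) : c ∈ Set.Icc (-ε) ε := by
  have h := mem_spectralSubspace.1 hx (outside ε) (continuous_outside ε)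
    (fun c hc => outside_eq_zero_of_mem_Icc hc)
  rw [cfc_apply_of_mem_eigspace (continuous_outside ε) hxc, smul_eq_zero, or_iff_left hx0,
    outside_cz_eq_zero_iff, abs_of_nonneg hε] at h
  exact abs_le.1 h

theorem mem_orthogonal_spectralSubspace {T : SelfAdjointOp H} {ε c : ℝ} (hε : 0 ≤ ε)
    (hc : c ∉ Set.Icc (-ε) ε) {x : H} (hx : x ∈ eigspace (resolventNegI T) (cz c)) :
    x ∈ (spectralSubspace T (Set.Icc (-ε) ε))ᗮ := by
  intro y hy
  have h := mem_spectralSubspace.1 hy (outside ε) (continuous_outside ε)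
    (fun c hc => outside_eq_zero_of_mem_Icc hc)
  have h1 := inner_cfc_apply (A := resolventNegI T) (g := outside ε) y x
  simp only [star_outside] at h1
  rw [h, inner_zero_left, cfc_apply_of_mem_eigspace (continuous_outside ε) hx, inner_smul_right,
    eq_comm, mul_eq_zero, outside_cz_eq_zero_iff, abs_of_nonneg hε] at h1
  exact h1.resolve_left fun h2 => hc (abs_le.1 h2)

/-- The sum of the eigenspaces of `T` for the eigenvalues in `J`. -/
def eigSum (T : SelfAdjointOp H) (J : Set ℝ) : Submodule ℂ H :=
  ⨆ c ∈ J, eigspace (resolventNegI T) (cz c)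

theorem eigspace_le_eigSum (T : SelfAdjointOp H) {J : Set ℝ} {c : ℝ} (hc : c ∈ J) :
    eigspace (resolventNegI T) (cz c) ≤ eigSum T J :=
  le_iSup₂_of_le c hc le_rfl

theorem eigSum_le {T : SelfAdjointOp H} {J : Set ℝ} {W : Submodule ℂ H}
    (h : ∀ c ∈ J, eigspace (resolventNegI T) (cz c) ≤ W) : eigSum T J ≤ W :=
  iSup₂_le h

theorem eigSum_union (T : SelfAdjointOp H) (J J' : Set ℝ) :
    eigSum T (J ∪ J') = eigSum T J ⊔ eigSum T J' :=
  iSup_union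

theorem eigSum_le_spectralSubspace (T : SelfAdjointOp H) {J K : Set ℝ} (h : J ⊆ K) :
    eigSum T J ≤ spectralSubspace T K :=
  eigSum_le fun _ hc => eigspace_le_spectralSubspace T (h hc)

/-- A real continuous function with the value `c` at `(c + i)⁻¹` for `|c| ≤ ε`. -/
def coord (ε : ℝ) (z : ℂ) : ℂ := ((z.re / max (‖z‖ ^ 2) (1 / (ε ^ 2 + 1)) : ℝ) : ℂ)

theorem continuous_coord (ε : ℝ) : Continuous (coord ε) := by
  unfold coord
  refine Complex.continuous_ofReal.comp (Continuous.div (by fun_prop) (by fun_prop) fun z => ?_)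
  exact (lt_of_lt_of_le (by positivity) (le_max_right _ _)).ne'

theorem coord_cz {ε c : ℝ} (hc : c ∈ Set.Icc (-ε) ε) : coord ε (cz c) = c := by
  have h1 : c ^ 2 ≤ ε ^ 2 := sq_le_sq' hc.1 hc.2
  rw [coord, norm_cz_sq, cz_re, max_eq_left]
  · field_simp
  · exact one_div_le_one_div_of_le (by positivity) (by linarith)

/-- A spectral subspace of finite dimension is spanned by eigenvectors. -/
theorem spectralSubspace_eq_eigSum (T : SelfAdjointOp H) {ε : ℝ} (hε : 0 ≤ ε)
    [FiniteDimensional ℂ (spectralSubspace T (Set.Icc (-ε) ε))] :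
    spectralSubspace T (Set.Icc (-ε) ε) = eigSum T (Set.Icc (-ε) ε) := by
  refine le_antisymm ?_ (eigSum_le_spectralSubspace T subset_rfl)
  set M := spectralSubspace T (Set.Icc (-ε) ε) with hM
  set A : H →L[ℂ] H := cfc (coord ε) (resolventNegI T) with hA
  have hsymm : (A : H →ₗ[ℂ] H).IsSymmetric := by
    intro x y
    have h := inner_cfc_apply (A := resolventNegI T) (g := coord ε) x y
    have h1 : (fun z => star (coord ε z)) = coord ε := by
      ext z
      simp [coord]
    rw [h1] at h
    exact h
  have hinv : ∀ x ∈ M, (A : H →ₗ[ℂ] H) x ∈ M := fun x hx => cfc_mem_spectralSubspace _ hx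
  have htop := (hsymm.restrict_invariant hinv).orthogonalComplement_iSup_eigenspaces_eq_bot
  rw [Submodule.orthogonal_eq_bot_iff] at htop
  have hle : M = Submodule.map M.subtype ⊤ := by simp
  rw [hle, ← htop, Submodule.map_iSup]
  refine iSup_le fun μ => ?_
  rintro _ ⟨⟨y, hyM⟩, hy, rfl⟩
  have hAy : A y = μ • y := congrArg Subtype.val (Module.End.mem_eigenspace_iff.1 hy)
  change y ∈ eigSum T (Set.Icc (-ε) ε)
  by_cases hy0 : y = 0
  · rw [hy0]; exact zero_mem _
  have h1 : resolventNegI T ((μ + Complex.I) • y) = y := by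
    have h2 := cfc_apply_of_mem_spectralSubspace (g := fun z => (z - 0) * (coord ε z + Complex.I))
      (by have := continuous_coord ε; fun_prop)
      (fun c hc => by rw [sub_zero, coord_cz hc, cz_mul]) hyM
    have hc := continuous_coord ε
    rw [cfc_sub_const_mul_apply (by fun_prop), zero_smul, sub_zero,
      cfc_add (resolventNegI T) (coord ε) (fun _ => Complex.I) (by fun_prop) (by fun_prop),
      cfc_const Complex.I (resolventNegI T), Algebra.algebraMap_eq_smul_one] at h2
    rw [add_smul, ← hAy]
    exact h2
  have hne : μ + Complex.I ≠ 0 := by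
    intro h
    rw [h, zero_smul, map_zero] at h1
    exact hy0 h1.symm
  have h3 : y ∈ eigspace (resolventNegI T) (μ + Complex.I)⁻¹ := by
    rw [mem_eigspace, eq_inv_smul_iff₀ hne, ← map_smul, h1]
  have h4 : (μ + Complex.I)⁻¹ ∈ spectrum ℂ (resolventNegI T) := by
    by_contra h
    rw [eigspace_eq_bot_of_notMem_spectrum h] at h3
    exact hy0 h3
  rcases spectrum_resolventNegI T h4 with h5 | ⟨c, h5⟩
  · exact absurd h5 (inv_ne_zero hne)
  · rw [h5] at h3
    exact eigspace_le_eigSum T (mem_Icc_of_mem_eigspace hε hy0 hyM h3) h3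

theorem nonnegPart_eq_eigSum (T : SelfAdjointOp H) {ε : ℝ} (hε : 0 ≤ ε) :
    nonnegPart T (spectralSubspace T (Set.Icc (-ε) ε)) = eigSum T (Set.Icc 0 ε) := by
  apply le_antisymm
  · refine Submodule.span_le.2 ?_
    rintro x ⟨hx, c, hc, hxc⟩
    rw [← mem_eigspace_resolventNegI] at hxc
    by_cases hx0 : x = 0
    · rw [hx0]; exact zero_mem _
    · exact eigspace_le_eigSum T (J := Set.Icc 0 ε) ⟨hc, (mem_Icc_of_mem_eigspace hε hx0 hx hxc).2⟩ hxc
  · refine eigSum_le fun c hc x hx => Submodule.subset_span ⟨?_, c, hc.1, ?_⟩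
    · exact eigspace_le_spectralSubspace T (K := Set.Icc (-ε) ε) ⟨by linarith [hc.1, hc.2], hc.2⟩ hx
    · exact mem_eigspace_resolventNegI.1 hx

theorem nonnegDim_eq (T : SelfAdjointOp H) {ε : ℝ} (hε : 0 ≤ ε) :
    nonnegDim T ε = Module.finrank ℂ (eigSum T (Set.Icc 0 ε)) := by
  rw [nonnegDim, nonnegPart_eq_eigSum T hε]

theorem spectralProjection_apply_of_mem {T : SelfAdjointOp H} {K : Set ℝ} {x : H}
    (hx : x ∈ spectralSubspace T K) : spectralProjection T K x = x :=
  Submodule.starProjection_eq_self_iff.2 hx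

theorem spectralProjection_apply_eigspace {T : SelfAdjointOp H} {ε c : ℝ} (hε : 0 ≤ ε)
    (hc : c ∉ Set.Icc (-ε) ε) {x : H} (hx : x ∈ eigspace (resolventNegI T) (cz c)) :
    spectralProjection T (Set.Icc (-ε) ε) x = 0 :=
  (Submodule.starProjection_apply_eq_zero_iff _).2 (mem_orthogonal_spectralSubspace hε hc hx)

theorem spectralProjection_apply_mem (T : SelfAdjointOp H) (K : Set ℝ) (x : H) :
    spectralProjection T K x ∈ spectralSubspace T K :=
  Submodule.starProjection_apply_mem _ x

/-- A continuous function with the value `0` at `(c + i)⁻¹` for `c ≤ 0` and the value `1` for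
`ε ≤ c ≤ ε'`. -/
def positiveRamp (ε ε' : ℝ) (z : ℂ) : ℂ :=
  ((max 0 (min 1 (z.re / (ε / (ε' ^ 2 + 1)))) : ℝ) : ℂ)

theorem continuous_positiveRamp (ε ε' : ℝ) : Continuous (positiveRamp ε ε') := by
  unfold positiveRamp
  fun_prop

theorem positiveRamp_cz_of_nonpos {ε ε' c : ℝ} (hε : 0 < ε) (hc : c ≤ 0) :
    positiveRamp ε ε' (cz c) = 0 := by
  have h1 : c / (c ^ 2 + 1) ≤ 0 := div_nonpos_of_nonpos_of_nonneg hc (by positivity)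
  have h2 : c / (c ^ 2 + 1) / (ε / (ε' ^ 2 + 1)) ≤ 0 :=
    div_nonpos_of_nonpos_of_nonneg h1 (by positivity)
  rw [positiveRamp, cz_re, max_eq_left ((min_le_right _ _).trans h2), Complex.ofReal_zero]

theorem positiveRamp_cz_of_mem {ε ε' c : ℝ} (hε : 0 < ε) (hc : c ∈ Set.Icc ε ε') :
    positiveRamp ε ε' (cz c) = 1 := by
  have h0 : 0 < c := hε.trans_le hc.1
  have h1 : 1 ≤ c / (c ^ 2 + 1) / (ε / (ε' ^ 2 + 1)) := by
    rw [le_div_iff₀ (by positivity), one_mul]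
    refine div_le_div₀ h0.le hc.1 (by positivity) ?_
    nlinarith [hc.2]
  rw [positiveRamp, cz_re, min_eq_left h1, max_eq_right zero_le_one, Complex.ofReal_one]

/-- The projection onto the sum of the eigenspaces with eigenvalue in `(ε, ε']`. -/
def gapProjection (T : SelfAdjointOp H) (ε ε' : ℝ) : H →L[ℂ] H :=
  cfc (positiveRamp ε ε') (resolventNegI T) ∘L
    (spectralProjection T (Set.Icc (-ε') ε') - spectralProjection T (Set.Icc (-ε) ε))

theorem gapProjection_apply (T : SelfAdjointOp H) (ε ε' : ℝ) (x : H) :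
    gapProjection T ε ε' x = cfc (positiveRamp ε ε') (resolventNegI T)
      (spectralProjection T (Set.Icc (-ε') ε') x - spectralProjection T (Set.Icc (-ε) ε) x) := rfl

theorem gapProjection_of_mem {T : SelfAdjointOp H} {ε ε' : ℝ} (hε : 0 < ε) {x : H}
    (hx : x ∈ eigSum T (Set.Ioc ε ε')) : gapProjection T ε ε' x = x := by
  suffices h : eigSum T (Set.Ioc ε ε') ≤ LinearMap.eqLocus (gapProjection T ε ε' : H →ₗ[ℂ] H)
      LinearMap.id from h hx
  refine eigSum_le fun c hc y hy => ?_
  change gapProjection T ε ε' y = y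
  have h0 : 0 < c := hε.trans hc.1
  rw [gapProjection_apply, spectralProjection_apply_of_mem
      (eigspace_le_spectralSubspace T (K := Set.Icc (-ε') ε') ⟨by linarith [hc.2], hc.2⟩ hy),
    spectralProjection_apply_eigspace hε.le (fun h => absurd h.2 (not_le.2 hc.1)) hy, sub_zero,
    cfc_apply_of_mem_eigspace (continuous_positiveRamp _ _) hy,
    positiveRamp_cz_of_mem hε ⟨hc.1.le, hc.2⟩, one_smul]

theorem gapProjection_apply_mem (T : SelfAdjointOp H) {ε ε' : ℝ} (hε : 0 < ε) (hεε' : ε ≤ ε')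
    [FiniteDimensional ℂ (spectralSubspace T (Set.Icc (-ε') ε'))] (x : H) :
    gapProjection T ε ε' x ∈ eigSum T (Set.Ioc ε ε') := by
  have hle : spectralSubspace T (Set.Icc (-ε) ε) ≤ spectralSubspace T (Set.Icc (-ε') ε') := by
    intro y hy
    rw [mem_spectralSubspace] at hy ⊢
    exact fun g hg hK => hy g hg fun c hc => hK c ⟨by linarith [hc.1], by linarith [hc.2]⟩
  have h1 : gapProjection T ε ε' x =
      gapProjection T ε ε' (spectralProjection T (Set.Icc (-ε') ε') x) := by
    rw [gapProjection_apply, gapProjection_apply]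
    congr 2
    · exact (spectralProjection_apply_of_mem (spectralProjection_apply_mem T _ x)).symm
    · exact congrArg (fun P : H →L[ℂ] H => P x)
        (Submodule.starProjection_comp_starProjection_of_le hle).symm
  rw [h1]
  have h2 : eigSum T (Set.Icc (-ε') ε') ≤
      (eigSum T (Set.Ioc ε ε')).comap (gapProjection T ε ε' : H →ₗ[ℂ] H) := by
    refine eigSum_le fun c hc y hy => ?_
    change gapProjection T ε ε' y ∈ eigSum T (Set.Ioc ε ε')
    by_cases hcε : c ∈ Set.Icc (-ε) ε
    · rw [gapProjection_apply, spectralProjection_apply_of_mem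
        (eigspace_le_spectralSubspace T hc hy), spectralProjection_apply_of_mem
        (eigspace_le_spectralSubspace T hcε hy), sub_self, map_zero]
      exact zero_mem _
    · by_cases hc0 : ε < c
      · have hy' := eigspace_le_eigSum T (J := Set.Ioc ε ε') ⟨hc0, hc.2⟩ hy
        rw [gapProjection_of_mem hε hy']
        exact hy'
      · have hcneg : c ≤ 0 := by
          by_contra hcon
          push Not at hcon hc0
          exact hcε ⟨by linarith, hc0⟩
        rw [gapProjection_apply, spectralProjection_apply_of_mem
          (eigspace_le_spectralSubspace T hc hy), spectralProjection_apply_eigspace hε.le hcε hy,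
          sub_zero, cfc_apply_of_mem_eigspace (continuous_positiveRamp _ _) hy,
          positiveRamp_cz_of_nonpos hε hcneg, zero_smul]
        exact zero_mem _
  apply h2
  rw [← spectralSubspace_eq_eigSum T (hε.le.trans hεε')]
  exact spectralProjection_apply_mem T _ x

theorem nonnegDim_eq_add (T : SelfAdjointOp H) {ε ε' : ℝ} (hε : 0 < ε) (hεε' : ε ≤ ε')
    [FiniteDimensional ℂ (spectralSubspace T (Set.Icc (-ε') ε'))] :
    nonnegDim T ε' = nonnegDim T ε + Module.finrank ℂ (eigSum T (Set.Ioc ε ε')) := by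
  have hε' := hε.le.trans hεε'
  rw [nonnegDim_eq T hε', nonnegDim_eq T hε.le, ← Set.Icc_union_Ioc_eq_Icc hε.le hεε', eigSum_union]
  have h1 : FiniteDimensional ℂ (eigSum T (Set.Icc 0 ε)) :=
    Submodule.finiteDimensional_of_le (eigSum_le_spectralSubspace T (K := Set.Icc (-ε') ε')
      fun c hc => ⟨by linarith [hc.1], by linarith [hc.2]⟩)
  have h2 : FiniteDimensional ℂ (eigSum T (Set.Ioc ε ε')) :=
    Submodule.finiteDimensional_of_le (eigSum_le_spectralSubspace T (K := Set.Icc (-ε') ε')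
      fun c hc => ⟨by linarith [hc.1], by linarith [hc.2]⟩)
  rw [← Submodule.finrank_sup_add_finrank_inf_eq]
  have h3 : eigSum T (Set.Icc 0 ε) ⊓ eigSum T (Set.Ioc ε ε') = ⊥ := by
    rw [eq_bot_iff]
    rintro x ⟨hx1, hx2⟩
    have h4 : spectralProjection T (Set.Icc (-ε) ε) x = x :=
      spectralProjection_apply_of_mem (eigSum_le_spectralSubspace T
        (K := Set.Icc (-ε) ε) (fun c hc => ⟨by linarith [hc.1], hc.2⟩) hx1)
    have h5 : eigSum T (Set.Ioc ε ε') ≤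
        LinearMap.ker (spectralProjection T (Set.Icc (-ε) ε) : H →ₗ[ℂ] H) :=
      eigSum_le fun c hc y hy =>
        spectralProjection_apply_eigspace hε.le (fun h => absurd h.2 (not_le.2 hc.1)) hy
    have h6 : spectralProjection T (Set.Icc (-ε) ε) x = 0 := h5 hx2
    rw [h4] at h6
    exact h6
  rw [h3, finrank_bot, add_zero]

theorem continuous_cfc_resolventNegI {g : ℂ → ℂ} (hg : Continuous g) :
    Continuous fun T : SelfAdjointOp H => cfc g (resolventNegI T) :=
  Continuous.cfc_of_mem_nhdsSet (s := Set.univ) g (by simp) continuous_resolventNegI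
    (fun _ => inferInstance) hg.continuousOn

variable {X : Type*} [TopologicalSpace X]

theorem continuousOn_nonnegDim_sub {f : X → SelfAdjointOp H} (hf : Continuous f) {S : Set X}
    {ε ε' : ℝ} (hε : 0 < ε) (hε' : 0 < ε')
    (hc : ContinuousOn (fun s => spectralProjection (f s) (Set.Icc (-ε) ε)) S)
    (hc' : ContinuousOn (fun s => spectralProjection (f s) (Set.Icc (-ε') ε')) S)
    (hfin : ∀ s ∈ S, FiniteDimensional ℂ (spectralSubspace (f s) (Set.Icc (-ε) ε)))
    (hfin' : ∀ s ∈ S, FiniteDimensional ℂ (spectralSubspace (f s) (Set.Icc (-ε') ε'))) :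
    ContinuousOn (fun s => (nonnegDim (f s) ε' : ℤ) - nonnegDim (f s) ε) S := by
  wlog h : ε ≤ ε' generalizing ε ε'
  · have := (this hε' hε hc' hc hfin' hfin (le_of_not_ge h)).neg
    refine this.congr fun s _ => ?_
    simp
  have heq : Set.EqOn (fun s => (nonnegDim (f s) ε' : ℤ) - nonnegDim (f s) ε)
      (fun s => (Module.finrank ℂ (eigSum (f s) (Set.Ioc ε ε')) : ℤ)) S := by
    intro s hs
    have := hfin' s hs
    simp only
    rw [nonnegDim_eq_add (f s) hε h]
    push_cast
    ring
  refine ContinuousOn.congr ?_ heq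
  have hQ : ContinuousOn (fun s => gapProjection (f s) ε ε') S := by
    unfold gapProjection
    exact ((continuous_cfc_resolventNegI (continuous_positiveRamp ε ε')).comp
      hf).continuousOn.clm_comp (hc'.sub hc)
  have hdim : ∀ s ∈ S, FiniteDimensional ℂ (eigSum (f s) (Set.Ioc ε ε')) := fun s hs => by
    have := hfin' s hs
    exact Submodule.finiteDimensional_of_le (eigSum_le_spectralSubspace (f s)
      (K := Set.Icc (-ε') ε') fun c hc => ⟨by linarith [hc.1], by linarith [hc.2]⟩)
  intro s hs
  refine ContinuousWithinAt.congr_of_eventuallyEq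
    (f := fun _ => (Module.finrank ℂ (eigSum (f s) (Set.Ioc ε ε')) : ℤ))
    continuousWithinAt_const ?_ rfl
  have hlt := (hQ s hs).eventually (Metric.ball_mem_nhds _ one_pos)
  filter_upwards [hlt, self_mem_nhdsWithin] with t ht htS
  have := hdim s hs
  have := hdim t htS
  have := hfin' s hs
  have := hfin' t htS
  replace ht : dist (gapProjection (f t) ε ε') (gapProjection (f s) ε ε') < 1 := ht
  rw [dist_eq_norm] at ht
  rw [finrank_eq_of_norm_sub_lt_one (fun x hx => gapProjection_of_mem hε hx)
    (gapProjection_apply_mem (f t) hε h) (fun x hx => gapProjection_of_mem hε hx)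
    (gapProjection_apply_mem (f s) hε h) ht]

end SpectralSubspace

section Subdivision

namespace Subdivision

/-- The sum of the increments of the functions `κ j` along the segments of `D`. -/
def incrementSum (D : Subdivision) (κ : Fin D.n → unitInterval → ℤ) : ℤ :=
  ∑ j, (κ j (D.t j.succ) - κ j (D.t j.castSucc))

/-- The nearest point of the `j`-th segment. -/
def clamp (D : Subdivision) (j : Fin D.n) (x : unitInterval) : unitInterval :=
  max (D.t j.castSucc) (min x (D.t j.succ))

/-- The increment from `0` to `x`. -/
def primitive (D : Subdivision) (κ : Fin D.n → unitInterval → ℤ) (x : unitInterval) : ℤ :=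
  ∑ j, (κ j (D.clamp j x) - κ j (D.t j.castSucc))

theorem t_castSucc_le (D : Subdivision) (j : Fin D.n) : D.t j.castSucc ≤ D.t j.succ :=
  D.t_strictMono.monotone (Fin.castSucc_le_succ j)

theorem clamp_of_le (D : Subdivision) {j : Fin D.n} {x : unitInterval}
    (h : x ≤ D.t j.castSucc) : D.clamp j x = D.t j.castSucc :=
  max_eq_left ((min_le_left _ _).trans h)

theorem clamp_of_ge (D : Subdivision) {j : Fin D.n} {x : unitInterval}
    (h : D.t j.succ ≤ x) : D.clamp j x = D.t j.succ := by
  rw [clamp, min_eq_right h, max_eq_right (D.t_castSucc_le j)]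

theorem clamp_of_mem (D : Subdivision) {j : Fin D.n} {x : unitInterval}
    (h : x ∈ D.segment j) : D.clamp j x = x := by
  rw [clamp, min_eq_left h.2, max_eq_right h.1]

theorem primitive_zero (D : Subdivision) (κ : Fin D.n → unitInterval → ℤ) :
    D.primitive κ 0 = 0 :=
  Finset.sum_eq_zero fun j _ => by rw [D.clamp_of_le unitInterval.nonneg', sub_self]

theorem primitive_one (D : Subdivision) (κ : Fin D.n → unitInterval → ℤ) :
    D.primitive κ 1 = D.incrementSum κ :=
  Finset.sum_congr rfl fun j _ => by rw [D.clamp_of_ge unitInterval.le_one']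

theorem primitive_sub (D : Subdivision) (κ : Fin D.n → unitInterval → ℤ) {j : Fin D.n}
    {x y : unitInterval} (hx : x ∈ D.segment j) (hy : y ∈ D.segment j) :
    D.primitive κ x - D.primitive κ y = κ j x - κ j y := by
  rw [primitive, primitive, ← Finset.sum_sub_distrib, Finset.sum_eq_single j]
  · rw [D.clamp_of_mem hx, D.clamp_of_mem hy]
    ring
  · intro i _ hij
    rcases lt_or_gt_of_ne hij with h | h
    · have h1 : D.t i.succ ≤ D.t j.castSucc :=
        D.t_strictMono.monotone (Fin.succ_le_castSucc_iff.2 h)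
      rw [D.clamp_of_ge (h1.trans hx.1), D.clamp_of_ge (h1.trans hy.1), sub_self]
    · have h1 : D.t j.succ ≤ D.t i.castSucc :=
        D.t_strictMono.monotone (Fin.succ_le_castSucc_iff.2 h)
      rw [D.clamp_of_le (hx.2.trans h1), D.clamp_of_le (hy.2.trans h1), sub_self]
  · simp

theorem exists_mem_segment (D : Subdivision) (x : unitInterval) : ∃ j, x ∈ D.segment j := by
  have key : ∀ i : Fin (D.n + 1), x ≤ D.t i → x ≤ D.t 0 ∨ ∃ j, x ∈ D.segment j := by
    intro i
    induction i using Fin.induction with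
    | zero => exact Or.inl
    | succ i ih =>
      intro h
      by_cases hx : x ≤ D.t i.castSucc
      · exact ih hx
      · exact Or.inr ⟨i, (not_le.1 hx).le, h⟩
  rcases key (Fin.last D.n) (by rw [D.t_last]; exact unitInterval.le_one') with h | h
  · have hx : x = D.t 0 := le_antisymm h (by rw [D.t_zero]; exact unitInterval.nonneg')
    have hn : D.n ≠ 0 := by
      intro hn
      have h1 : (0 : Fin (D.n + 1)) = Fin.last D.n := Fin.ext (by simp [hn])
      have h2 := D.t_last
      rw [← h1, D.t_zero] at h2
      exact zero_ne_one h2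
    refine ⟨⟨0, Nat.pos_of_ne_zero hn⟩, ?_⟩
    have h3 : (⟨0, Nat.pos_of_ne_zero hn⟩ : Fin D.n).castSucc = 0 := rfl
    have h4 := D.t_castSucc_le ⟨0, Nat.pos_of_ne_zero hn⟩
    rw [h3] at h4
    exact ⟨by rw [h3, hx], by rw [hx]; exact h4⟩
  · exact h

theorem isClosed_segment (D : Subdivision) (j : Fin D.n) : IsClosed (D.segment j) := isClosed_Icc

theorem incrementSum_eq {D D' : Subdivision} {κ : Fin D.n → unitInterval → ℤ}
    {κ' : Fin D'.n → unitInterval → ℤ}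
    (h : ∀ j k, ContinuousOn (fun x => κ j x - κ' k x) (D.segment j ∩ D'.segment k)) :
    D.incrementSum κ = D'.incrementSum κ' := by
  set Φ : unitInterval → ℤ := fun x => D.primitive κ x - D'.primitive κ' x with hΦ
  have hc : Continuous Φ := by
    refine LocallyFinite.continuous (f := fun i : Fin D.n × Fin D'.n =>
      D.segment i.1 ∩ D'.segment i.2) (locallyFinite_of_finite _) ?_
      (fun i => (D.isClosed_segment _).inter (D'.isClosed_segment _)) ?_
    · rw [Set.eq_univ_iff_forall]
      intro x
      obtain ⟨j, hj⟩ := D.exists_mem_segment x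
      obtain ⟨k, hk⟩ := D'.exists_mem_segment x
      exact Set.mem_iUnion.2 ⟨(j, k), hj, hk⟩
    · rintro ⟨j, k⟩
      rcases (D.segment j ∩ D'.segment k).eq_empty_or_nonempty with he | ⟨y, hy⟩
      · simp only [he]
        exact continuousOn_empty _
      · have h1 : Set.EqOn Φ (fun x => (κ j x - κ' k x) + (Φ y - (κ j y - κ' k y)))
            (D.segment j ∩ D'.segment k) := by
          intro x hx
          have e1 := D.primitive_sub κ hx.1 hy.1
          have e2 := D'.primitive_sub κ' hx.2 hy.2
          simp only [hΦ]
          linarith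
        exact ((h j k).add continuousOn_const).congr h1
  have h01 : Φ 1 = Φ 0 := PreconnectedSpace.constant inferInstance hc
  simp only [hΦ, primitive_zero, primitive_one, sub_self] at h01
  exact sub_eq_zero.1 h01

/-- A subdivision with segments inside the members of an open cover. -/
theorem exists_of_open_cover {p : ℝ → unitInterval → Prop}
    (h : ∀ s, ∃ ε > 0, ∀ᶠ t in nhds s, p ε t) :
    ∃ D : Subdivision, ∀ j, ∀ s ∈ D.segment j, p (D.ε j) s := by
  choose ε hε hp using h
  obtain ⟨δ, hδ, hball⟩ := lebesgue_number_lemma_of_metric (s := Set.univ)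
    (c := fun s => interior {t | p (ε s) t}) isCompact_univ (fun s => isOpen_interior)
    (fun s _ => Set.mem_iUnion.2 ⟨s, mem_interior_iff_mem_nhds.2 (hp s)⟩)
  obtain ⟨n, hn⟩ := exists_nat_one_div_lt hδ
  have hn0 : (0 : ℝ) < n + 1 := by positivity
  let t : Fin (n + 1 + 1) → unitInterval := fun i =>
    ⟨(i : ℝ) / (n + 1), by positivity, by
      rw [div_le_one hn0]
      exact_mod_cast Nat.lt_succ_iff.1 i.2⟩
  have hball' : ∀ j : Fin (n + 1), ∃ s, Metric.ball (t j.castSucc) δ ⊆ {t | p (ε s) t} := fun j => by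
    obtain ⟨s, hs⟩ := hball (t j.castSucc) (Set.mem_univ _)
    exact ⟨s, hs.trans interior_subset⟩
  choose s hs using hball'
  refine ⟨⟨n + 1, t, ?_, ?_, ?_, fun j => ε (s j), fun j => hε _⟩, fun j x hx => hs j ?_⟩
  · intro a b hab
    have h1 : ((a : ℕ) : ℝ) < (b : ℕ) := by exact_mod_cast hab
    exact Subtype.mk_lt_mk.2 (div_lt_div_of_pos_right h1 hn0)
  · apply Subtype.ext
    simp [t]
  · apply Subtype.ext
    simp only [t, Fin.val_last, Set.Icc.coe_one]
    push_cast
    exact div_self hn0.ne'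
  · have h1 : (t j.castSucc : ℝ) ≤ x := hx.1
    have h2 : (x : ℝ) ≤ t j.succ := hx.2
    have h3 : (t j.succ : ℝ) = t j.castSucc + 1 / (n + 1) := by
      simp only [t, Fin.val_succ, Fin.val_castSucc]
      push_cast
      ring
    rw [Metric.mem_ball, Subtype.dist_eq, Real.dist_eq, abs_of_nonneg (by linarith)]
    linarith

end Subdivision

end Subdivision

section Phillips

variable {H : Type*} [NormedAddCommGroup H] [InnerProductSpace ℂ H] [CompleteSpace H]

theorem phillipsSum_eq {f : unitInterval → FredholmSA H} (hf : Continuous f) {D D' : Subdivision}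
    (hD : D.IsPhillips f) (hD' : D'.IsPhillips f) : D.phillipsSum f = D'.phillipsSum f := by
  refine Subdivision.incrementSum_eq (κ := fun j s => (nonnegDim (f s).1 (D.ε j) : ℤ))
    (κ' := fun j s => (nonnegDim (f s).1 (D'.ε j) : ℤ)) fun j k => ?_
  exact continuousOn_nonnegDim_sub (f := fun s => (f s).1) (continuous_subtype_val.comp hf)
    (D'.ε_pos k) (D.ε_pos j) ((hD'.continuousOn k).mono Set.inter_subset_right)
    ((hD.continuousOn j).mono Set.inter_subset_left) (fun s hs => hD'.finiteRank k s hs.2)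
    (fun s hs => hD.finiteRank j s hs.1)

end Phillips

section Independent

variable {ι K V : Type*} [Field K] [AddCommGroup V] [Module K V]

theorem finrank_biSup_finset {p : ι → Submodule K V} (hp : iSupIndep p) (s : Finset ι)
    (hs : ∀ i ∈ s, FiniteDimensional K (p i)) :
    FiniteDimensional K (⨆ i ∈ s, p i : Submodule K V) ∧
      Module.finrank K (⨆ i ∈ s, p i : Submodule K V) = ∑ i ∈ s, Module.finrank K (p i) := by
  classical
  induction s using Finset.induction_on with
  | empty =>
    have h : (⨆ i ∈ (∅ : Finset ι), p i) = ⊥ := by simp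
    rw [h]
    exact ⟨inferInstance, by simp⟩
  | insert a s ha ih =>
    obtain ⟨h1, h2⟩ := ih fun i hi => hs i (Finset.mem_insert_of_mem hi)
    have h3 := hs a (Finset.mem_insert_self a s)
    rw [Finset.iSup_insert, Finset.sum_insert ha]
    refine ⟨inferInstance, ?_⟩
    have h4 : Disjoint (p a) (⨆ i ∈ s, p i) := hp.disjoint_biSup (y := (s : Set ι)) ha
    rw [← h2, ← Submodule.finrank_sup_add_finrank_inf_eq, h4.eq_bot, finrank_bot, add_zero]

theorem finrank_biSup_eq_finsum {p : ι → Submodule K V} (hp : iSupIndep p) (J : Set ι)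
    [FiniteDimensional K (⨆ i ∈ J, p i : Submodule K V)] :
    Module.finrank K (⨆ i ∈ J, p i : Submodule K V) = ∑ᶠ i ∈ J, Module.finrank K (p i) := by
  have hfin : ∀ i ∈ J, FiniteDimensional K (p i) := fun i hi =>
    Submodule.finiteDimensional_of_le (le_iSup₂_of_le i hi le_rfl : p i ≤ ⨆ i ∈ J, p i)
  set F : Set ι := {i | i ∈ J ∧ p i ≠ ⊥} with hF
  have hFfin : F.Finite := by
    by_contra hinf
    obtain ⟨s, hsF, hcard⟩ := Set.Infinite.exists_subset_card_eq hinf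
      (Module.finrank K (⨆ i ∈ J, p i : Submodule K V) + 1)
    obtain ⟨h1, h2⟩ := finrank_biSup_finset hp s fun i hi => hfin i (hsF hi).1
    have h3 : (⨆ i ∈ s, p i) ≤ ⨆ i ∈ J, p i :=
      iSup₂_le fun i hi => le_iSup₂_of_le i (hsF hi).1 le_rfl
    have h4 := Submodule.finrank_mono h3
    have h5 : s.card ≤ ∑ i ∈ s, Module.finrank K (p i) := by
      rw [Finset.card_eq_sum_ones]
      refine Finset.sum_le_sum fun i hi => ?_
      have := hfin i (hsF hi).1
      exact Nat.one_le_iff_ne_zero.2 fun h => (hsF hi).2 (Submodule.finrank_eq_zero.1 h)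
    omega
  have h1 : (⨆ i ∈ J, p i) = ⨆ i ∈ hFfin.toFinset, p i := by
    apply le_antisymm
    · refine iSup₂_le fun i hi => ?_
      by_cases h0 : p i = ⊥
      · rw [h0]; exact bot_le
      · exact le_iSup₂_of_le i (hFfin.mem_toFinset.2 ⟨hi, h0⟩) le_rfl
    · exact iSup₂_le fun i hi => le_iSup₂_of_le i (hFfin.mem_toFinset.1 hi).1 le_rfl
  have h2 := (finrank_biSup_finset hp hFfin.toFinset
    fun i hi => hfin i (hFfin.mem_toFinset.1 hi).1).2
  rw [h1, h2, eq_comm]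
  refine finsum_mem_eq_sum_of_inter_support_eq _ ?_
  ext i
  simp only [Set.mem_inter_iff, Function.mem_support, Set.Finite.coe_toFinset, hF, Set.mem_ofPred_eq]
  constructor
  · rintro ⟨hi, h⟩
    refine ⟨⟨hi, fun h0 => h ?_⟩, h⟩
    rw [h0, finrank_bot]
  · rintro ⟨⟨hi, _⟩, h⟩
    exact ⟨hi, h⟩

end Independent

section Winding

variable {H : Type*} [NormedAddCommGroup H] [InnerProductSpace ℂ H] [CompleteSpace H]

theorem exp_eq_one_sub {θ : ℝ} (h : Real.cos (θ / 2) ≠ 0) :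
    Complex.exp (((Real.pi + θ : ℝ) : ℂ) * Complex.I) =
      1 - 2 * Complex.I * cz (Real.tan (θ / 2)) := by
  have hc : (Real.cos (θ / 2) : ℂ) ≠ 0 := by exact_mod_cast h
  have hcz : cz (Real.tan (θ / 2)) = -Complex.I * Real.cos (θ / 2) *
      (Real.cos (θ / 2) + Real.sin (θ / 2) * Complex.I) := by
    rw [cz, inv_eq_iff_eq_inv, eq_comm]
    apply inv_eq_of_mul_eq_one_left
    rw [Real.tan_eq_sin_div_cos, Complex.ofReal_div]
    field_simp
    have h1 : (Real.cos (θ / 2) : ℂ) ^ 2 + (Real.sin (θ / 2) : ℂ) ^ 2 = 1 := by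
      exact_mod_cast Real.cos_sq_add_sin_sq (θ / 2)
    linear_combination h1 -
      ((Real.cos (θ / 2) : ℂ) ^ 2 + (Real.sin (θ / 2) : ℂ) ^ 2 +
        (Real.cos (θ / 2) : ℂ) * Real.sin (θ / 2) * Complex.I) * Complex.I_sq
  have h2 : (θ : ℝ) = 2 * (θ / 2) := by ring
  rw [hcz, Complex.exp_mul_I, ← Complex.ofReal_cos, ← Complex.ofReal_sin, add_comm Real.pi θ,
    Real.cos_add_pi, Real.sin_add_pi]
  nth_rewrite 1 [h2]
  nth_rewrite 2 [h2]
  rw [Real.cos_two_mul, Real.sin_two_mul]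
  push_cast
  linear_combination (-2 * Complex.cos (θ / 2) *
    (Complex.cos (θ / 2) + Complex.sin (θ / 2) * Complex.I)) * Complex.I_sq

theorem cos_half_pos {θ ε : ℝ} (hθ : |θ| ≤ ε) (hε : ε < Real.pi) : 0 < Real.cos (θ / 2) := by
  have := abs_le.1 hθ
  exact Real.cos_pos_of_mem_Ioo ⟨by linarith, by linarith⟩

theorem half_mem_Ioo {θ ε : ℝ} (hθ : |θ| ≤ ε) (hε : ε < Real.pi) :
    θ / 2 ∈ Set.Ioo (-(Real.pi / 2)) (Real.pi / 2) := by
  have := abs_le.1 hθ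
  exact ⟨by linarith, by linarith⟩

theorem cayley_sub_exp (T : SelfAdjointOp H) {θ : ℝ} (h : Real.cos (θ / 2) ≠ 0) :
    cayley T - Complex.exp (((Real.pi + θ : ℝ) : ℂ) * Complex.I) • (1 : H →L[ℂ] H) =
      (-(2 * Complex.I)) • (resolventNegI T - cz (Real.tan (θ / 2)) • (1 : H →L[ℂ] H)) := by
  rw [exp_eq_one_sub h, cayley_eq]
  module

theorem ker_cayley_sub_exp (T : SelfAdjointOp H) {θ : ℝ} (h : Real.cos (θ / 2) ≠ 0) :
    LinearMap.ker ((cayley T - Complex.exp (((Real.pi + θ : ℝ) : ℂ) * Complex.I) •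
      (1 : H →L[ℂ] H) : H →L[ℂ] H) : H →ₗ[ℂ] H) =
      eigspace (resolventNegI T) (cz (Real.tan (θ / 2))) := by
  rw [cayley_sub_exp T h]
  exact LinearMap.ker_smul _ _ (by simp)

theorem range_cayley_sub_exp (T : SelfAdjointOp H) {θ : ℝ} (h : Real.cos (θ / 2) ≠ 0) :
    LinearMap.range ((cayley T - Complex.exp (((Real.pi + θ : ℝ) : ℂ) * Complex.I) •
      (1 : H →L[ℂ] H) : H →L[ℂ] H) : H →ₗ[ℂ] H) =
      LinearMap.range ((resolventNegI T - cz (Real.tan (θ / 2)) • (1 : H →L[ℂ] H) : H →L[ℂ] H) :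
        H →ₗ[ℂ] H) := by
  rw [cayley_sub_exp T h]
  exact LinearMap.range_smul _ _ (by simp)

/-- The spectral subspace is of finite dimension if `T - c` is semi-Fredholm for all `c`. -/
theorem finiteDimensional_spectralSubspace (T : SelfAdjointOp H) {ε : ℝ}
    (hker : ∀ c ∈ Set.Icc (-ε) ε, FiniteDimensional ℂ (eigspace (resolventNegI T) (cz c)))
    (hbelow : ∀ c ∈ Set.Icc (-ε) ε, ∃ η > 0, BoundedBelowAt (resolventNegI T) (cz c) η) :
    FiniteDimensional ℂ (spectralSubspace T (Set.Icc (-ε) ε)) := by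
  have key : ∃ g : ℂ → ℝ, Continuous g ∧ (∀ z, 0 ≤ g z) ∧ (∀ c ∈ Set.Icc (-ε) ε, 0 < g (cz c)) ∧
      ∃ W : Submodule ℂ H, FiniteDimensional ℂ W ∧
        ∀ x, cfc (fun z => (g z : ℂ)) (resolventNegI T) x ∈ W := by
    refine isCompact_Icc.induction_on (p := fun S => ∃ g : ℂ → ℝ, Continuous g ∧ (∀ z, 0 ≤ g z) ∧
      (∀ c ∈ S, 0 < g (cz c)) ∧ ∃ W : Submodule ℂ H, FiniteDimensional ℂ W ∧
        ∀ x, cfc (fun z => (g z : ℂ)) (resolventNegI T) x ∈ W) ?_ ?_ ?_ ?_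
    · refine ⟨fun _ => 0, continuous_const, fun _ => le_rfl, by simp, ⊥, inferInstance, fun x => ?_⟩
      simp only [Complex.ofReal_zero]
      rw [cfc_const_zero]
      exact zero_mem _
    · rintro S S' hSS' ⟨g, h1, h2, h3, h4⟩
      exact ⟨g, h1, h2, fun c hc => h3 c (hSS' hc), h4⟩
    · rintro S S' ⟨g, h1, h2, h3, W, h4, h5⟩ ⟨g', h1', h2', h3', W', h4', h5'⟩
      refine ⟨fun z => g z + g' z, h1.add h1', fun z => add_nonneg (h2 z) (h2' z), ?_, W ⊔ W',
        inferInstance, fun x => ?_⟩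
      · rintro c (hc | hc)
        · exact add_pos_of_pos_of_nonneg (h3 c hc) (h2' _)
        · exact add_pos_of_nonneg_of_pos (h2 _) (h3' c hc)
      · simp only [Complex.ofReal_add]
        rw [cfc_add (resolventNegI T) (fun z => (g z : ℂ)) (fun z => (g' z : ℂ)) (by fun_prop)
          (by fun_prop)]
        exact Submodule.add_mem_sup (h5 x) (h5' x)
    · intro c hc
      obtain ⟨η, hη, hb⟩ := hbelow c hc
      refine ⟨{c' | ‖cz c' - cz c‖ < η / 2}, mem_nhdsWithin_of_mem_nhds ?_,
        fun z => max 0 (η / 2 - ‖z - cz c‖), by fun_prop, fun z => le_max_left _ _, fun c' hc' => ?_,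
        eigspace (resolventNegI T) (cz c), hker c hc, fun x => ?_⟩
      · have h1 : Continuous fun c' => ‖cz c' - cz c‖ := by
          have := continuous_cz
          fun_prop
        exact (isOpen_lt h1 continuous_const).mem_nhds (by simp [hη])
      · exact lt_max_of_lt_right (sub_pos.2 hc')
      · exact apply_cfc_of_boundedBelowAt hb (half_lt_self hη) (half_pos hη)
          (continuous_bump (cz c) (η / 2)) (fun u hu => (bump_ne_zero_iff.1 hu).le) x
  obtain ⟨g, h1, h2, h3, W, h4, h5⟩ := key
  obtain ⟨m, hm, hle⟩ := isCompact_Icc.exists_forall_le' (f := fun c => g (cz c))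
    (h1.comp continuous_cz).continuousOn h3
  refine Submodule.finiteDimensional_of_le (S₂ := W) fun x hx => ?_
  have hmax : ∀ z, 0 < max (g z) m := fun z => lt_of_lt_of_le hm (le_max_right _ _)
  have hqc : Continuous fun z => (((max (g z) m)⁻¹ : ℝ) : ℂ) :=
    Complex.continuous_ofReal.comp ((h1.max continuous_const).inv₀ fun z => (hmax z).ne')
  have h6 := cfc_apply_of_mem_spectralSubspace
    (g := fun z => (g z : ℂ) * (((max (g z) m)⁻¹ : ℝ) : ℂ)) (by fun_prop) (fun c hc => by
      rw [max_eq_left (hle c hc), ← Complex.ofReal_mul, mul_inv_cancel₀ (h3 c hc).ne',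
        Complex.ofReal_one]) hx
  rw [cfc_mul_apply (by fun_prop) hqc] at h6
  rw [← h6]
  exact h5 _

/-- A continuous function that is `1` at distance at most `ρ` from `-i`, and `0` at distance at
least `ρ + r`. -/
def plateau (ρ r : ℝ) (z : ℂ) : ℂ := ((max 0 (min 1 ((ρ + r - ‖z + Complex.I‖) / r)) : ℝ) : ℂ)

theorem continuous_plateau (ρ r : ℝ) : Continuous (plateau ρ r) := by
  unfold plateau
  fun_prop

theorem plateau_of_le {ρ r : ℝ} (hr : 0 < r) {z : ℂ} (h : ‖z + Complex.I‖ ≤ ρ) :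
    plateau ρ r z = 1 := by
  have h1 : 1 ≤ (ρ + r - ‖z + Complex.I‖) / r := by
    rw [le_div_iff₀ hr]; linarith
  rw [plateau, min_eq_left h1, max_eq_right zero_le_one, Complex.ofReal_one]

theorem plateau_of_ge {ρ r : ℝ} (hr : 0 < r) {z : ℂ} (h : ρ + r ≤ ‖z + Complex.I‖) :
    plateau ρ r z = 0 := by
  have h1 : (ρ + r - ‖z + Complex.I‖) / r ≤ 0 :=
    div_nonpos_of_nonpos_of_nonneg (by linarith) hr.le
  rw [plateau, max_eq_left ((min_le_right _ _).trans h1), Complex.ofReal_zero]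

theorem exists_mem_Icc_of_mem_spectrum {T : SelfAdjointOp H} {z : ℂ}
    (hz : z ∈ spectrum ℂ (resolventNegI T)) {ε : ℝ} (hε : 0 ≤ ε)
    (h : ‖z + Complex.I‖ ≤ rad ε) : ∃ c ∈ Set.Icc (-ε) ε, z = cz c := by
  rcases spectrum_resolventNegI T hz with rfl | ⟨c, rfl⟩
  · rw [zero_add, Complex.norm_I] at h
    exact absurd h (not_le.2 (rad_lt_one ε))
  · refine ⟨c, abs_le.1 ?_, rfl⟩
    have h1 := rad_le_rad_iff.1 h
    rwa [abs_of_nonneg hε] at h1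

theorem spectralProjection_eq_cfc (T : SelfAdjointOp H) {ε r : ℝ} (hε : 0 ≤ ε) (hr : 0 < r)
    (hgap : ∀ z ∈ spectrum ℂ (resolventNegI T), r < |‖z + Complex.I‖ - rad ε|) :
    spectralProjection T (Set.Icc (-ε) ε) = cfc (plateau (rad ε) r) (resolventNegI T) := by
  have hc := continuous_plateau (rad ε) r
  ext x
  rw [spectralProjection]
  refine Submodule.eq_starProjection_of_mem_of_inner_eq_zero
    (cfc_apply_mem_spectralSubspace hc (fun z hz hne => ?_) x) fun y hy => ?_
  · refine exists_mem_Icc_of_mem_spectrum hz hε ?_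
    by_contra hcon
    push Not at hcon
    have h1 := hgap z hz
    rw [abs_of_pos (by linarith)] at h1
    exact hne (plateau_of_ge hr (by linarith))
  · have h1 := inner_cfc_apply (A := resolventNegI T) (g := plateau (rad ε) r) x y
    have h2 : (fun z => star (plateau (rad ε) r z)) = plateau (rad ε) r := by
      ext z
      simp [plateau]
    rw [h2, cfc_apply_of_mem_spectralSubspace hc (fun c hc => plateau_of_le hr ?_) hy] at h1
    · rw [inner_sub_left, h1, sub_self]
    · exact rad_le_rad_iff.2 ((abs_le.2 hc).trans (le_abs_self _))

theorem eventually_spectrum_subset {T₀ : SelfAdjointOp H} {O : Set ℂ} (hO : IsOpen O)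
    (h : spectrum ℂ (resolventNegI T₀) ⊆ O) :
    ∀ᶠ T in nhds T₀, spectrum ℂ (resolventNegI T) ⊆ O := by
  have h1 := (upperHemicontinuous_spectrum ℂ (H →L[ℂ] H)).upperHemicontinuousAt
    (resolventNegI T₀) O (hO.mem_nhdsSet.2 h)
  exact (continuous_resolventNegI.continuousAt.eventually h1).mono fun T hT =>
    subset_of_mem_nhdsSet hT

theorem continuousAt_spectralProjection {T₀ : SelfAdjointOp H} {ε : ℝ} (hε : 0 < ε)
    (h1 : cz ε ∉ spectrum ℂ (resolventNegI T₀)) (h2 : cz (-ε) ∉ spectrum ℂ (resolventNegI T₀)) :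
    ContinuousAt (fun T => spectralProjection T (Set.Icc (-ε) ε)) T₀ := by
  have hpos : ∀ z ∈ spectrum ℂ (resolventNegI T₀), 0 < |‖z + Complex.I‖ - rad ε| := by
    intro z hz
    rw [abs_pos, sub_ne_zero]
    intro heq
    rcases spectrum_resolventNegI T₀ hz with rfl | ⟨c, rfl⟩
    · rw [zero_add, Complex.norm_I] at heq
      exact (rad_lt_one ε).ne heq.symm
    · rcases abs_eq_abs.1 (rad_eq_rad_iff.1 heq) with rfl | rfl
      · exact h1 hz
      · exact h2 hz
  obtain ⟨a, ha, hle⟩ := (spectrum.isCompact (𝕜 := ℂ) (resolventNegI T₀)).exists_forall_le'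
    (f := fun z => |‖z + Complex.I‖ - rad ε|) (by fun_prop) hpos
  have hO : IsOpen {z : ℂ | a / 2 < |‖z + Complex.I‖ - rad ε|} :=
    isOpen_lt continuous_const (by fun_prop)
  have hev := eventually_spectrum_subset hO fun z hz => (half_lt_self ha).trans_le (hle z hz)
  refine (continuous_cfc_resolventNegI
    (continuous_plateau (rad ε) (a / 2))).continuousAt.congr ?_
  filter_upwards [hev] with T hT
  exact (spectralProjection_eq_cfc T hε.le (half_pos ha) fun z hz => hT hz).symm

theorem iSupIndep_eigspace (T : SelfAdjointOp H) :
    iSupIndep fun c => eigspace (resolventNegI T) (cz c) := by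
  have h := Module.End.eigenspaces_iSupIndep (resolventNegI T : Module.End ℂ H)
  have h1 : ∀ z, Module.End.eigenspace (resolventNegI T : Module.End ℂ H) z =
      eigspace (resolventNegI T) z := by
    intro z
    ext x
    rw [Module.End.mem_eigenspace_iff, mem_eigspace]
    rfl
  simp only [funext h1] at h
  exact h.comp cz_injective

theorem tan_half_bijOn {ε : ℝ} (h0 : 0 < ε) (hε : ε < Real.pi) :
    Set.BijOn (fun θ => Real.tan (θ / 2)) (Set.Ico 0 ε) (Set.Ico 0 (Real.tan (ε / 2))) := by
  have hmem : ∀ θ ∈ Set.Icc 0 ε, θ / 2 ∈ Set.Ioo (-(Real.pi / 2)) (Real.pi / 2) := fun θ hθ =>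
    half_mem_Ioo (abs_le.2 ⟨by linarith [hθ.1], hθ.2⟩) hε
  refine ⟨fun θ hθ => ⟨?_, ?_⟩, fun θ hθ θ' hθ' heq => ?_, fun c hc => ?_⟩
  · exact Real.tan_nonneg_of_nonneg_of_le_pi_div_two (by linarith [hθ.1]) (by linarith [hθ.2])
  · exact Real.strictMonoOn_tan (hmem θ ⟨hθ.1, hθ.2.le⟩) (hmem ε ⟨h0.le, le_rfl⟩)
      (by linarith [hθ.2])
  · have := Real.injOn_tan (hmem θ ⟨hθ.1, hθ.2.le⟩) (hmem θ' ⟨hθ'.1, hθ'.2.le⟩) heq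
    linarith
  · refine ⟨2 * Real.arctan c, ⟨?_, ?_⟩, ?_⟩
    · have := Real.arctan_nonneg.2 hc.1
      linarith
    · have h1 := Real.arctan_strictMono hc.2
      rw [Real.arctan_tan (hmem ε ⟨h0.le, le_rfl⟩).1 (hmem ε ⟨h0.le, le_rfl⟩).2] at h1
      linarith
    · simp only [mul_div_cancel_left₀ _ (two_ne_zero' ℝ), Real.tan_arctan]

theorem eigenvalueCount_cayley (T : SelfAdjointOp H) {ε : ℝ} (h0 : 0 < ε) (hε : ε < Real.pi)
    (hker : eigspace (resolventNegI T) (cz (Real.tan (ε / 2))) = ⊥)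
    [FiniteDimensional ℂ
      (spectralSubspace T (Set.Icc (-Real.tan (ε / 2)) (Real.tan (ε / 2))))] :
    eigenvalueCount (cayley T) ε = nonnegDim T (Real.tan (ε / 2)) := by
  have htan : 0 < Real.tan (ε / 2) :=
    Real.tan_pos_of_pos_of_lt_pi_div_two (by linarith) (by linarith)
  have h1 : eigSum T (Set.Icc 0 (Real.tan (ε / 2))) = eigSum T (Set.Ico 0 (Real.tan (ε / 2))) := by
    rw [← Set.Ico_union_right htan.le, eigSum_union]
    refine sup_eq_left.2 (eigSum_le fun c hc => ?_)
    rw [Set.mem_singleton_iff.1 hc, hker]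
    exact bot_le
  have h2 : FiniteDimensional ℂ (eigSum T (Set.Ico 0 (Real.tan (ε / 2)))) :=
    Submodule.finiteDimensional_of_le (eigSum_le_spectralSubspace T
      (K := Set.Icc (-Real.tan (ε / 2)) (Real.tan (ε / 2)))
      fun c hc => ⟨by linarith [hc.1], hc.2.le⟩)
  rw [nonnegDim_eq T htan.le, h1, eigSum, @finrank_biSup_eq_finsum _ _ _ _ _ _ _
    (iSupIndep_eigspace T) _ h2, eigenvalueCount]
  refine finsum_mem_eq_of_bijOn _ (tan_half_bijOn h0 hε) fun θ hθ => ?_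
  rw [ker_cayley_sub_exp T
    (cos_half_pos (abs_le.2 ⟨by linarith [hθ.1], hθ.2.le⟩) hε).ne']

end Winding

section Existence

variable {H : Type*} [NormedAddCommGroup H] [InnerProductSpace ℂ H] [CompleteSpace H]

theorem isFredholm_sub_cz (T : SelfAdjointOp H) {ε c : ℝ} (hc : |c| < ε)
    [FiniteDimensional ℂ (spectralSubspace T (Set.Icc (-ε) ε))] {a : ℂ} (ha : a ≠ 0) :
    (a • (resolventNegI T - cz c • (1 : H →L[ℂ] H))).IsFredholm := by
  have hε : 0 < ε := (abs_nonneg c).trans_lt hc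
  have hrad : rad c < rad ε := rad_lt_rad (by rwa [abs_of_pos hε])
  set r := (rad ε - rad c) / 2 with hr
  have hr0 : 0 < r := by linarith
  set ψ := plateau (rad c + r) r with hψ
  have hψc : Continuous ψ := continuous_plateau _ _
  have hmax : ∀ z : ℂ, 0 < max (‖z - cz c‖ ^ 2) (r ^ 2) := fun z =>
    lt_of_lt_of_le (by positivity) (le_max_right _ _)
  set q : ℂ → ℂ := fun z => (1 - ψ z) * (star (z - cz c) *
    (((max (‖z - cz c‖ ^ 2) (r ^ 2))⁻¹ : ℝ) : ℂ)) with hq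
  have hqc : Continuous q := by
    have h1 : Continuous fun z : ℂ => (((max (‖z - cz c‖ ^ 2) (r ^ 2))⁻¹ : ℝ) : ℂ) :=
      Complex.continuous_ofReal.comp
        (Continuous.inv₀ (by fun_prop) fun z => (hmax z).ne')
    fun_prop
  have hmul : ∀ z, (z - cz c) * q z = 1 - ψ z := by
    intro z
    by_cases hz : ‖z + Complex.I‖ ≤ rad c + r
    · have : ψ z = 1 := plateau_of_le hr0 hz
      simp [hq, this]
    · have h1 : r ≤ ‖z - cz c‖ := by
        have h2 : ‖z + Complex.I‖ ≤ ‖z - cz c‖ + ‖cz c + Complex.I‖ := by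
          have h3 : z + Complex.I = (z - cz c) + (cz c + Complex.I) := by ring
          rw [h3]
          exact norm_add_le _ _
        have h4 : ‖cz c + Complex.I‖ = rad c := rfl
        push Not at hz
        linarith
      have h2 : (z - cz c) * star (z - cz c) = ((‖z - cz c‖ ^ 2 : ℝ) : ℂ) := by
        rw [Complex.ofReal_pow]
        exact RCLike.mul_conj (z - cz c)
      have h3 : 0 < ‖z - cz c‖ := hr0.trans_le h1
      simp only [hq]
      rw [max_eq_left (pow_le_pow_left₀ hr0.le h1 2), mul_left_comm, ← mul_assoc (z - cz c), h2,
        ← Complex.ofReal_mul, mul_inv_cancel₀ (by positivity), Complex.ofReal_one, mul_one]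
  have hleft : ∀ x, resolventNegI T (cfc q (resolventNegI T) x) -
      cz c • cfc q (resolventNegI T) x = x - cfc ψ (resolventNegI T) x := by
    intro x
    rw [← cfc_sub_const_mul_apply hqc, ← cfc_one_sub_apply hψc]
    simp only [hmul]
  refine isFredholm_of_mul_eq_one_sub (S := a⁻¹ • cfc q (resolventNegI T))
    (F := cfc ψ (resolventNegI T)) (W := spectralSubspace T (Set.Icc (-ε) ε))
    (cfc_apply_mem_spectralSubspace hψc fun z hz hne => ?_) (fun x => ?_) fun x => ?_
  · refine exists_mem_Icc_of_mem_spectrum hz hε.le ?_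
    by_contra hcon
    push Not at hcon
    exact hne (plateau_of_ge hr0 (by linarith))
  · change a⁻¹ • cfc q (resolventNegI T) (a • (resolventNegI T x - cz c • x)) = _
    rw [map_smul, smul_smul, inv_mul_cancel₀ ha, one_smul, map_sub, map_smul,
      ← cfc_apply_self_comm, hleft]
  · change a • (resolventNegI T (a⁻¹ • cfc q (resolventNegI T) x) -
      cz c • (a⁻¹ • cfc q (resolventNegI T) x)) = _
    rw [map_smul, smul_comm (cz c), ← smul_sub, smul_smul, mul_inv_cancel₀ ha, one_smul, hleft]

theorem isClosed_range_of_isFredholmOp {T : SelfAdjointOp H} (hT : IsFredholmOp T.1) :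
    IsClosed (LinearMap.range ((resolventNegI T - cz 0 • (1 : H →L[ℂ] H) : H →L[ℂ] H) :
      H →ₗ[ℂ] H) : Set H) := by
  have h : LinearMap.range ((resolventNegI T - cz 0 • (1 : H →L[ℂ] H) : H →L[ℂ] H) :
      H →ₗ[ℂ] H) = LinearMap.range T.1.toFun := by
    have hval : ∀ x, (resolventNegI T - cz 0 • (1 : H →L[ℂ] H)) (addI T x) =
        Complex.I • T.1.toFun x := by
      intro x
      rw [sub_apply, smul_apply, one_apply_eq_self, resolventNegI_addI, addI_apply, cz_zero]
      change (x : H) - -Complex.I • (T.1.toFun x + Complex.I • (x : H)) = _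
      rw [smul_add, smul_smul, neg_mul, Complex.I_mul_I]
      module
    apply le_antisymm
    · rintro _ ⟨y, rfl⟩
      obtain ⟨x, rfl⟩ := (addI_bijective T).2 y
      refine ⟨Complex.I • x, ?_⟩
      rw [map_smul]
      exact (hval x).symm
    · rintro _ ⟨x, rfl⟩
      refine ⟨addI T (-Complex.I • x), ?_⟩
      refine (hval _).trans ?_
      rw [map_smul, smul_smul, mul_neg, Complex.I_mul_I, neg_neg, one_smul]
  rw [h]
  exact hT.isClosed_range

theorem finiteDimensional_eigspace_zero {T : SelfAdjointOp H} (hT : IsFredholmOp T.1) :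
    FiniteDimensional ℂ (eigspace (resolventNegI T) (cz 0)) := by
  have h := hT.finiteDimensional_ker
  refine Submodule.finiteDimensional_of_le
    (S₂ := (LinearMap.ker T.1.toFun).map T.1.domain.subtype) fun x hx => ?_
  rw [mem_eigspace_resolventNegI, Complex.ofReal_zero, zero_smul] at hx
  obtain ⟨w, hw1, hw2⟩ := (LinearPMap.mem_graph_iff _).1 hx
  exact ⟨w, hw2, hw1⟩

/-- The spectrum of a Fredholm operator near `0`. -/
theorem exists_gap {T : SelfAdjointOp H} (hT : IsFredholmOp T.1) :
    ∃ ε > 0, FiniteDimensional ℂ (spectralSubspace T (Set.Icc (-ε) ε)) ∧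
      ∀ c, c ≠ 0 → |c| ≤ ε → cz c ∉ spectrum ℂ (resolventNegI T) := by
  obtain ⟨η, hη, hb⟩ := exists_boundedBelowAt (isClosed_range_of_isFredholmOp hT)
  have h1 : ∀ᶠ c in nhds (0 : ℝ), rad c < η :=
    continuous_rad.continuousAt.eventually_lt continuousAt_const (by rwa [rad_zero])
  obtain ⟨ε, hε, hball⟩ := Metric.eventually_nhds_iff.1 h1
  have hradη : rad (ε / 2) < η := hball (by
    rw [Real.dist_eq, sub_zero, abs_of_pos (half_pos hε)]
    exact half_lt_self hε)
  have hz : ∀ z : ℂ, z - cz 0 = z + Complex.I := fun z => by rw [cz_zero]; ring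
  have hr0 : 0 < (η - rad (ε / 2)) / 2 := by linarith
  refine ⟨ε / 2, half_pos hε, ?_, fun c hc0 hc hmem => hc0 ?_⟩
  · have h2 := finiteDimensional_eigspace_zero hT
    refine Submodule.finiteDimensional_of_le (S₂ := eigspace (resolventNegI T) (cz 0))
      fun x hx => ?_
    rw [← cfc_apply_of_mem_spectralSubspace (continuous_plateau (rad (ε / 2)) _)
      (fun c hc => plateau_of_le hr0 (rad_le_rad_iff.2 ((abs_le.2 hc).trans (le_abs_self _)))) hx]
    refine apply_cfc_of_boundedBelowAt hb (η' := (η + rad (ε / 2)) / 2) (by linarith)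
      (by have : 0 ≤ rad (ε / 2) := norm_nonneg _
          linarith) (continuous_plateau _ _) (fun z hne => ?_) x
    rw [hz]
    by_contra hcon
    push Not at hcon
    exact hne (plateau_of_ge hr0 (by linarith))
  · refine cz_injective (eq_of_mem_spectrum_of_boundedBelowAt hb hmem ?_)
    rw [hz]
    refine lt_of_le_of_lt ?_ hradη
    exact rad_le_rad_iff.2 (hc.trans (le_abs_self _))

theorem abs_tan_half_le {θ ε : ℝ} (hθ : |θ| ≤ ε) (hε : ε < Real.pi) :
    |Real.tan (θ / 2)| ≤ Real.tan (ε / 2) := by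
  have h0 : 0 ≤ ε := (abs_nonneg θ).trans hθ
  have h1 := half_mem_Ioo hθ hε
  have h2 := half_mem_Ioo (abs_of_nonneg h0).le hε
  have h3 := half_mem_Ioo (θ := -ε) (by rw [abs_neg, abs_of_nonneg h0]) hε
  have h4 := abs_le.1 hθ
  refine abs_le.2 ⟨?_, ?_⟩
  · rw [← Real.tan_neg, ← neg_div]
    exact Real.strictMonoOn_tan.monotoneOn h3 h1 (by linarith)
  · exact Real.strictMonoOn_tan.monotoneOn h1 h2 (by linarith)

/-- The conditions for an admissible subdivision, at one point of the path. -/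
structure WindingAt (T : SelfAdjointOp H) (ε : ℝ) : Prop where
  lt_pi : ε < Real.pi
  isFredholm : ∀ θ : ℝ, |θ| ≤ ε →
    (cayley T - Complex.exp (((Real.pi + θ : ℝ) : ℂ) * Complex.I) • (1 : H →L[ℂ] H)).IsFredholm
  ker_add : eigspace (cayley T) (Complex.exp (((Real.pi + ε : ℝ) : ℂ) * Complex.I)) = ⊥
  ker_sub : eigspace (cayley T) (Complex.exp (((Real.pi - ε : ℝ) : ℂ) * Complex.I)) = ⊥

theorem exists_eventually_windingAt {T₀ : SelfAdjointOp H} (hT : IsFredholmOp T₀.1) :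
    ∃ ε > 0, ∀ᶠ T in nhds T₀, WindingAt T ε := by
  obtain ⟨b, hb, hfin, hgap⟩ := exists_gap hT
  have habs : ∀ c : ℝ, 0 < c → c ≤ b → cz c ∉ spectrum ℂ (resolventNegI T₀) ∧
      cz (-c) ∉ spectrum ℂ (resolventNegI T₀) := fun c h0 h =>
    ⟨hgap c h0.ne' (by rwa [abs_of_pos h0]),
      hgap (-c) (neg_ne_zero.2 h0.ne') (by rwa [abs_neg, abs_of_pos h0])⟩
  have hcont := continuousAt_spectralProjection hb (habs b hb le_rfl).1 (habs b hb le_rfl).2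
  have hev1 := hcont.eventually (Metric.ball_mem_nhds _ one_pos)
  have hsub : ∀ z, z ∉ spectrum ℂ (resolventNegI T₀) →
      ∀ᶠ T in nhds T₀, z ∉ spectrum ℂ (resolventNegI T) := fun z hz =>
    (eventually_spectrum_subset (O := {z}ᶜ) isOpen_compl_singleton
      (Set.subset_compl_singleton_iff.2 hz)).mono fun T hT => Set.subset_compl_singleton_iff.1 hT
  obtain ⟨h3, h4⟩ := habs (b / 2) (half_pos hb) (half_le_self hb.le)
  have hε0 : 0 < 2 * Real.arctan (b / 2) := by
    have := Real.arctan_pos.2 (half_pos hb)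
    linarith
  have hεpi : 2 * Real.arctan (b / 2) < Real.pi := by
    have := Real.arctan_lt_pi_div_two (b / 2)
    linarith
  have htan : Real.tan (2 * Real.arctan (b / 2) / 2) = b / 2 := by
    rw [mul_div_cancel_left₀ _ (two_ne_zero' ℝ), Real.tan_arctan]
  refine ⟨2 * Real.arctan (b / 2), hε0, ?_⟩
  filter_upwards [hev1, hsub _ h3, hsub _ h4] with T hT1 hT3 hT4
  replace hT1 : dist (spectralProjection T (Set.Icc (-b) b))
    (spectralProjection T₀ (Set.Icc (-b) b)) < 1 := hT1
  rw [dist_eq_norm] at hT1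
  have hfinT : FiniteDimensional ℂ (spectralSubspace T (Set.Icc (-b) b)) :=
    Module.Finite.of_injective _ (injective_restrict_of_norm_sub_lt_one
      (fun x hx => spectralProjection_apply_of_mem hx) (spectralProjection_apply_mem T₀ _) hT1)
  refine ⟨hεpi, fun θ hθ => ?_, ?_, ?_⟩
  · have h5 := abs_tan_half_le hθ hεpi
    rw [htan] at h5
    rw [cayley_sub_exp T (cos_half_pos hθ hεpi).ne']
    exact isFredholm_sub_cz T (h5.trans_lt (half_lt_self hb)) (by simp)
  · rw [eigspace, ker_cayley_sub_exp T (cos_half_pos (abs_of_pos hε0).le hεpi).ne', htan]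
    exact eigspace_eq_bot_of_notMem_spectrum hT3
  · rw [eigspace, sub_eq_add_neg Real.pi, ker_cayley_sub_exp T
      (cos_half_pos (by rw [abs_neg, abs_of_pos hε0]) hεpi).ne', neg_div, Real.tan_neg, htan]
    exact eigspace_eq_bot_of_notMem_spectrum hT4

theorem exists_isWinding {f : unitInterval → FredholmSA H} (hf : Continuous f) :
    ∃ D : Subdivision, D.IsWinding (cayleyPath f) := by
  obtain ⟨D, hD⟩ := Subdivision.exists_of_open_cover (p := fun ε s => WindingAt (f s).1 ε)
    fun s => by
      obtain ⟨ε, hε, h⟩ := exists_eventually_windingAt (f s).2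
      exact ⟨ε, hε, (continuous_subtype_val.comp hf).continuousAt.eventually h⟩
  exact ⟨D, fun j => (hD j _ (Set.left_mem_Icc.2 (D.t_castSucc_le j))).lt_pi,
    fun j s hs => (hD j s hs).isFredholm, fun j s hs => (hD j s hs).ker_add,
    fun j s hs => (hD j s hs).ker_sub⟩

end Existence

section Comparison

variable {H : Type*} [NormedAddCommGroup H] [InnerProductSpace ℂ H] [CompleteSpace H]

theorem WindingAt.finiteDimensional {T : SelfAdjointOp H} {ε : ℝ} (h : WindingAt T ε)
    (hε : 0 < ε) : FiniteDimensional ℂ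
      (spectralSubspace T (Set.Icc (-Real.tan (ε / 2)) (Real.tan (ε / 2)))) := by
  have key : ∀ c ∈ Set.Icc (-Real.tan (ε / 2)) (Real.tan (ε / 2)), ∃ θ : ℝ, |θ| ≤ ε ∧
      Real.tan (θ / 2) = c := by
    intro c hc
    have h1 := half_mem_Ioo (abs_of_pos hε).le h.lt_pi
    have h2 : Real.arctan (Real.tan (ε / 2)) = ε / 2 := Real.arctan_tan h1.1 h1.2
    have h3 := Real.arctan_strictMono.monotone hc.1
    have h4 := Real.arctan_strictMono.monotone hc.2
    rw [Real.arctan_neg, h2] at h3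
    rw [h2] at h4
    refine ⟨2 * Real.arctan c, abs_le.2 ⟨by linarith, by linarith⟩, ?_⟩
    rw [mul_div_cancel_left₀ _ (two_ne_zero' ℝ), Real.tan_arctan]
  refine finiteDimensional_spectralSubspace T (fun c hc => ?_) fun c hc => ?_
  · obtain ⟨θ, hθ, rfl⟩ := key c hc
    rw [← ker_cayley_sub_exp T (cos_half_pos hθ h.lt_pi).ne']
    exact (h.isFredholm θ hθ).finite_ker
  · obtain ⟨θ, hθ, rfl⟩ := key c hc
    apply exists_boundedBelowAt
    rw [← range_cayley_sub_exp T (cos_half_pos hθ h.lt_pi).ne']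
    exact (h.isFredholm θ hθ).isClosed_range

theorem WindingAt.notMem_spectrum {T : SelfAdjointOp H} {ε : ℝ} (h : WindingAt T ε) (hε : 0 < ε) :
    cz (Real.tan (ε / 2)) ∉ spectrum ℂ (resolventNegI T) ∧
      cz (-Real.tan (ε / 2)) ∉ spectrum ℂ (resolventNegI T) := by
  have key : ∀ θ : ℝ, |θ| ≤ ε →
      eigspace (cayley T) (Complex.exp (((Real.pi + θ : ℝ) : ℂ) * Complex.I)) = ⊥ →
      cz (Real.tan (θ / 2)) ∉ spectrum ℂ (resolventNegI T) := by
    intro θ hθ hker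
    have hcos := (cos_half_pos hθ h.lt_pi).ne'
    rw [eigspace, ker_cayley_sub_exp T hcos] at hker
    have hcl := (h.isFredholm θ hθ).isClosed_range
    rw [range_cayley_sub_exp T hcos] at hcl
    obtain ⟨η, hη, hb⟩ := exists_boundedBelowAt hcl
    exact notMem_spectrum_of_boundedBelowAt hη hb hker
  refine ⟨key ε (abs_of_pos hε).le h.ker_add, ?_⟩
  have h1 := key (-ε) (by rw [abs_neg, abs_of_pos hε]) (by
    rw [← sub_eq_add_neg]
    exact h.ker_sub)
  rwa [neg_div, Real.tan_neg] at h1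

/-- The subdivision with `tan (ε j / 2)` in place of `ε j`. -/
def Subdivision.tanHalf (D : Subdivision) (h : ∀ j, D.ε j < Real.pi) : Subdivision where
  n := D.n
  t := D.t
  t_strictMono := D.t_strictMono
  t_zero := D.t_zero
  t_last := D.t_last
  ε j := Real.tan (D.ε j / 2)
  ε_pos j := Real.tan_pos_of_pos_of_lt_pi_div_two (half_pos (D.ε_pos j)) (by linarith [h j])

theorem Subdivision.IsWinding.windingAt {D : Subdivision} {f : unitInterval → FredholmSA H}
    (h : D.IsWinding (cayleyPath f)) (j : Fin D.n) {s : unitInterval} (hs : s ∈ D.segment j) :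
    WindingAt (f s).1 (D.ε j) :=
  ⟨h.lt_pi j, h.isFredholm j s hs, h.ker_add j s hs, h.ker_sub j s hs⟩

theorem Subdivision.IsWinding.isPhillips {D : Subdivision} {f : unitInterval → FredholmSA H}
    (hf : Continuous f) (h : D.IsWinding (cayleyPath f)) : (D.tanHalf h.lt_pi).IsPhillips f where
  continuousOn j s hs := by
    have h1 := (h.windingAt j hs).notMem_spectrum (D.ε_pos j)
    have h2 := continuousAt_spectralProjection ((D.tanHalf h.lt_pi).ε_pos j) h1.1 h1.2
    exact (ContinuousAt.comp (f := fun s => (f s).1) h2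
      (continuous_subtype_val.comp hf).continuousAt).continuousWithinAt
  finiteRank j s hs := (h.windingAt j hs).finiteDimensional (D.ε_pos j)

theorem Subdivision.IsWinding.windingSum_eq {D : Subdivision} {f : unitInterval → FredholmSA H}
    (h : D.IsWinding (cayleyPath f)) :
    D.windingSum (cayleyPath f) = (D.tanHalf h.lt_pi).phillipsSum f := by
  have key : ∀ j, ∀ s ∈ D.segment j,
      eigenvalueCount (cayleyPath f s) (D.ε j) = nonnegDim (f s).1 (Real.tan (D.ε j / 2)) := by
    intro j s hs
    have h1 := h.windingAt j hs
    have := h1.finiteDimensional (D.ε_pos j)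
    exact eigenvalueCount_cayley (f s).1 (D.ε_pos j) (h.lt_pi j)
      (eigspace_eq_bot_of_notMem_spectrum (h1.notMem_spectrum (D.ε_pos j)).1)
  refine Finset.sum_congr rfl fun j _ => ?_
  rw [key j _ (Set.right_mem_Icc.2 (D.t_castSucc_le j)),
    key j _ (Set.left_mem_Icc.2 (D.t_castSucc_le j))]
  rfl

end Comparison

end SpectralFlow

end

open SpectralFlow in
theorem propositionp {H : Type*} [NormedAddCommGroup H] [InnerProductSpace ℂ H] [CompleteSpace H]
    (f : unitInterval → FredholmSA H) (hf : Continuous f) :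
    (∃ D : Subdivision, D.IsWinding (cayleyPath f)) ∧
    (∀ D : Subdivision, D.IsWinding (cayleyPath f) →
      D.windingSum (cayleyPath f) = spectralFlowCayley f) ∧
    (∃ D : Subdivision, D.IsPhillips f) ∧
    (∀ D : Subdivision, D.IsPhillips f → D.phillipsSum f = spectralFlowPhillips f) ∧
    spectralFlowCayley f = spectralFlowPhillips f := by
  have hW := exists_isWinding hf
  have hP : ∃ D : Subdivision, D.IsPhillips f := ⟨_, hW.choose_spec.isPhillips hf⟩
  have hPhillips : ∀ D : Subdivision, D.IsPhillips f → D.phillipsSum f = spectralFlowPhillips f := by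
    intro D hD
    rw [spectralFlowPhillips, dif_pos hP]
    exact phillipsSum_eq hf hD hP.choose_spec
  have hWinding : ∀ D : Subdivision, D.IsWinding (cayleyPath f) →
      D.windingSum (cayleyPath f) = spectralFlowPhillips f := fun D hD => by
    rw [hD.windingSum_eq]
    exact hPhillips _ (hD.isPhillips hf)
  have hEq : spectralFlowCayley f = spectralFlowPhillips f := by
    rw [spectralFlowCayley, windingNumber, dif_pos hW]
    exact hWinding _ hW.choose_spec
  exact ⟨hW, fun D hD => (hWinding D hD).trans hEq.symm, hP, hPhillips, hEq⟩
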